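/- Let $M$ be a Hausdorff connected smooth $n$-manifold with base point $*$ and let $G$ be a Lie group with Lie algebra $\mathfrak g$. Let $PM$ be the set of piecewise smooth paths $[0,1]\to M$ starting at $*$ and $\Omega M\subset PM$ the set of loops at $*$. A composition $\alpha\circ\beta$ means first $\beta$, then $\alpha$; $\alpha^{-1}$ is the reversed path; $K(p,i)(t):=p(it)$. A family of paths $\tilde\psi:U\to PM$, with associated map $\psi(u,i)=\tilde\psi[u](i)$, is called smooth if $\psi$ is continuous on $U\times[0,1]$ and smooth on $U\times[i_k,i_{k+1}]$ for some partition $0=i_0<\dots<i_N=1$. A loop is thin if it can be contracted to the constant loop, by a homotopy of based loops, inside its own image. Let $H:\Omega M\to G$ be a holonomy map, i.e. (1) $H(\alpha\circ\beta)=H(\beta)H(\alpha)$; (2) $H(\alpha)=e$ for every thin loop $\alpha$; (3) $H\circ\tilde\Omega:U\to G$ is smooth for every smooth family of loops $\tilde\Omega:U\to\Omega M$, $U\subset\mathbb R^m$ open, $m\in\mathbb N$. Let $E:=(PM\times G)/T$, where $(p,g)\,T\,(p',g')$ iff $p(1)=p'(1)$ and $g'=H(p^{-1}\circ p')g$; write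 $\{p,g\}$ for the class of $(p,g)$, $\pi\{p,g\}:=p(1)$, $\{p,h\}g:=\{p,hg\}$. $E$ carries the smooth structure given by the local trivializations $C_\psi:U\times G\to\pi^{-1}(U)$, $C_\psi(u,g)=\{\tilde\psi[u],g\}$, where $U\subset M$ is open and $\tilde\psi:U\to PM$ is a smooth family with $\tilde\psi[u](1)=u$. For $a\in E$ let $V_a:=\ker(\pi_*:T_aE\to T_{\pi(a)}M)$ and let $\Gamma_a\subset T_aE$ be the span of all vectors $\frac{d}{di}\{K(r,i),h\}|_{i=j}$, where $r\in PM$ is smooth near $j\in(0,1)$ and $\{K(r,j),h\}=a$. Let $P_V$ be the projection of $T_aE$ onto $V_a$ along $\Gamma_a$, and define the connection 1-form $$\omega_a:T_aE\to\mathfrak g,\qquad \omega_aX_a:=(a^{-1})_*P_VX_a ,$$ where $a^{-1}:\pi^{-1}(\pi(a))\to G$ is the inverse of $g\mapsto ag$. Then the following hold. (0) $\omega$ is well defined: for every $a\in E$, $T_aE=V_a\oplus\Gamma_a$, and the differential at $e$ of $G\ni g\mapsto ag\in E$ is injective with image $V_a$. Moreover, for every $a\in E$, every $X_a\in T_aE$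 can be written as $X_a=\frac{d}{di}\{\tilde\chi[i],g(i)\}|_{i=j}$ with $\{\tilde\chi[j],g(j)\}=a$, where $0<j<1$ and $\tilde\chi:[0,1]\to PM$, $g:[0,1]\to G$ are smooth near $j$, and where the path $p(i):=\tilde\chi[i](1)$ is piecewise smooth with $p(0)=*$. (1) Let $0<j<1$, and let $\tilde\chi:[0,1]\to PM$ and $g:[0,1]\to G$ be smooth near $j$ (the former as a family of paths), such that $p(i):=\tilde\chi[i](1)$ is a piecewise smooth path in $M$. Put $a=\{\tilde\chi[j],g(j)\}$. Then $i\mapsto\{\tilde\chi[i],g(i)\}$ is differentiable at $j$, and with $X_a=\frac{d}{di}\{\tilde\chi[i],g(i)\}|_{i=j}$, $$\omega_aX_a=g(j)^{-1}\,\frac{d}{di}\,H\big(\tilde\chi[i]^{-1}\circ K(p,i)\circ K(p,j)^{-1}\circ\tilde\chi[j]\big)\,g(i)\Big|_{i=j},$$ where the function of $i$ that is differentiated is differentiable at $j$ with value $g(j)$ there, and $g(j)^{-1}$ acts by left translation $T_{g(j)}G\to\mathfrak g$. (2) Let $\tilde\psi:U\to PM$ be a smooth family as above, $\sigma(x):=C_\psi(x,e)$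 the corresponding local section, and let $y_1,\dots,y_n$ be smooth coordinates on an open subset of $U$ which identify it with a convex open subset of $\mathbb R^n$ (for example with $\mathbb R^n$), with coordinate vector fields $\partial_\mu$. For $x,y$ in this subset let $T_{y,x}(i)=x+i(y-x)$ be the straight segment from $x$ to $y$ in these coordinates. Then $\sigma$ is differentiable, the map $y\mapsto H(\tilde\psi[y]^{-1}\circ T_{y,x}\circ\tilde\psi[x])$ is differentiable at $y=x$ with value $e$ there, and the local coefficients of $\omega$ are $$A_\mu(x):=(\sigma^*\omega)_x\,\partial_\mu(x)=\frac{\partial}{\partial y_\mu}H\big(\tilde\psi[y]^{-1}\circ T_{y,x}\circ\tilde\psi[x]\big)\Big|_{y=x},\qquad \mu=1,\dots,n.$$ -/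

import Mathlib

open Set Filter Topology
open scoped Manifold ContDiff

namespace LoopHolonomy

abbrev Euc (n : ℕ) : Type := EuclideanSpace ℝ (Fin n)

section Paths

variable {M : Type*}

/-- The composition `α ∘ β` of two paths: first go along `β`, then along `α`. -/
noncomputable def pcomp (α β : unitInterval → M) : unitInterval → M := fun t =>
  if (t : ℝ) ≤ 1 / 2 then IccExtend zero_le_one β (2 * (t : ℝ))
  else IccExtend zero_le_one α (2 * (t : ℝ) - 1)

/-- The inverse of a path. -/
def pinv (α : unitInterval → M) : unitInterval → M := fun t => α (unitInterval.symm t)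

/-- The contraction `K(p,i)` of a path, `K(p,i)(j) = p(ij)`. -/
def contr (p : unitInterval → M) (i : unitInterval) : unitInterval → M := fun j => p (i * j)

end Paths

infixr:80 " ⊙ " => pcomp

section Families

variable (n : ℕ) {M : Type*} [TopologicalSpace M] [ChartedSpace (Euc n) M]

/-- Piecewise smoothness of a path: it is continuous, and there is a finite set `S` of break points
such that the path is smooth on every closed subinterval of `[0,1]` without break points in its
interior. -/
def PiecewiseSmooth (γ : unitInterval → M) : Prop :=
  Continuous γ ∧ ∃ S : Finset ℝ, ∀ a c : ℝ, 0 ≤ a → a ≤ c → c ≤ 1 → Disjoint (Ioo a c) (S : Set ℝ) →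
    ContMDiffOn 𝓘(ℝ, ℝ) (𝓡 n) ∞ (IccExtend zero_le_one γ) (Icc a c)

/-- Smoothness on the parameter set `U` of a family of paths `ψ : U → PM`: the associated map
`U × [0,1] → M` is continuous, and there is a finite set `S` of break points such that it is smooth
on `U × [a,c]` for every closed subinterval `[a,c]` of `[0,1]` without break points in its
interior. -/
def SmoothFamilyOn {F : Type*} [NormedAddCommGroup F] [NormedSpace ℝ F] {H' : Type*}
    [TopologicalSpace H'] (J : ModelWithCorners ℝ F H') {N : Type*} [TopologicalSpace N]
    [ChartedSpace H' N] (U : Set N) (ψ : N → unitInterval → M) : Prop :=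
  ContinuousOn (fun z : N × unitInterval => ψ z.1 z.2) (U ×ˢ univ) ∧
  ∃ S : Finset ℝ, ∀ a c : ℝ, 0 ≤ a → a ≤ c → c ≤ 1 → Disjoint (Ioo a c) (S : Set ℝ) →
    ContMDiffOn (J.prod 𝓘(ℝ, ℝ)) (𝓡 n) ∞
      (fun z : N × ℝ => IccExtend zero_le_one (ψ z.1) z.2) (U ×ˢ Icc a c)

variable {n}
variable {F : Type*} [NormedAddCommGroup F] [NormedSpace ℝ F] {H' : Type*}
    [TopologicalSpace H'] {J : ModelWithCorners ℝ F H'} {N : Type*} [TopologicalSpace N]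
    [ChartedSpace H' N]
    {F₂ : Type*} [NormedAddCommGroup F₂] [NormedSpace ℝ F₂] {H₂ : Type*}
    [TopologicalSpace H₂] {J₂ : ModelWithCorners ℝ F₂ H₂} {N₂ : Type*} [TopologicalSpace N₂]
    [ChartedSpace H₂ N₂]

theorem SmoothFamilyOn.const {γ : unitInterval → M} (h : PiecewiseSmooth n γ) (U : Set N) :
    SmoothFamilyOn n J U (fun _ => γ) := by
  obtain ⟨hc, S, hS⟩ := h
  refine ⟨(hc.comp continuous_snd).continuousOn, S, fun a c h0 hac h1 hd => ?_⟩
  exact (hS a c h0 hac h1 hd).comp contMDiff_snd.contMDiffOn (fun z hz => hz.2)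

theorem SmoothFamilyOn.comp {U : Set N} {ψ : N → unitInterval → M} (h : SmoothFamilyOn n J U ψ)
    {f : N₂ → N} {V : Set N₂} (hf : ContMDiffOn J₂ J ∞ f V) (hm : MapsTo f V U) :
    SmoothFamilyOn n J₂ V (fun v => ψ (f v)) := by
  obtain ⟨hc, S, hS⟩ := h
  refine ⟨?_, S, fun a c h0 hac h1 hd => ?_⟩
  · refine hc.comp (f := fun z : N₂ × unitInterval => (f z.1, z.2)) ?_ (fun z hz => ⟨hm hz.1, trivial⟩)
    exact (hf.continuousOn.comp continuousOn_fst (fun z hz => hz.1)).prodMk continuousOn_snd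
  · refine (hS a c h0 hac h1 hd).comp (f := fun z : N₂ × ℝ => (f z.1, z.2)) ?_
      (fun z hz => ⟨hm hz.1, hz.2⟩)
    exact (hf.comp contMDiff_fst.contMDiffOn (fun z hz => hz.1)).prodMk
      contMDiff_snd.contMDiffOn

theorem SmoothFamilyOn.mono {U V : Set N} {ψ : N → unitInterval → M} (h : SmoothFamilyOn n J U ψ)
    (hV : V ⊆ U) : SmoothFamilyOn n J V ψ := by
  obtain ⟨hc, S, hS⟩ := h
  exact ⟨hc.mono (prod_mono hV Subset.rfl), S, fun a c h0 hac h1 hd =>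
    (hS a c h0 hac h1 hd).mono (prod_mono hV Subset.rfl)⟩

theorem SmoothFamilyOn.congr {U : Set N} {ψ ψ' : N → unitInterval → M} (h : SmoothFamilyOn n J U ψ)
    (hψ : ∀ u ∈ U, ψ' u = ψ u) : SmoothFamilyOn n J U ψ' := by
  obtain ⟨hc, S, hS⟩ := h
  refine ⟨hc.congr (fun z hz => by simp [hψ z.1 hz.1]), S, fun a c h0 hac h1 hd =>
    (hS a c h0 hac h1 hd).congr (fun z hz => by simp [hψ z.1 hz.1])⟩

theorem SmoothFamilyOn.piecewiseSmooth {U : Set N} {ψ : N → unitInterval → M}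
    (h : SmoothFamilyOn n J U ψ) {u : N} (hu : u ∈ U) : PiecewiseSmooth n (ψ u) := by
  obtain ⟨hc, S, hS⟩ := h
  refine ⟨?_, S, fun a c h0 hac h1 hd => ?_⟩
  · rw [← continuousOn_univ]
    exact hc.comp (f := fun t : unitInterval => (u, t)) (by fun_prop) (fun t _ => ⟨hu, trivial⟩)
  · exact (hS a c h0 hac h1 hd).comp (f := fun t : ℝ => (u, t))
      (contMDiffOn_const.prodMk contMDiffOn_id) (fun t ht => ⟨hu, ht⟩)

theorem SmoothFamilyOn.pinv {U : Set N} {ψ : N → unitInterval → M} (h : SmoothFamilyOn n J U ψ) :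
    SmoothFamilyOn n J U (fun u => pinv (ψ u)) := by
  classical
  obtain ⟨hc, S, hS⟩ := h
  refine ⟨?_, S.image (fun s => 1 - s), fun a c h0 hac h1 hd => ?_⟩
  · exact hc.comp (f := fun z : N × unitInterval => (z.1, unitInterval.symm z.2)) (by fun_prop)
      (fun z hz => ⟨hz.1, trivial⟩)
  · have hd' : Disjoint (Ioo (1 - c) (1 - a)) (S : Set ℝ) := by
      rw [Set.disjoint_left] at hd ⊢
      intro x hx hxS
      exact hd (a := 1 - x) ⟨by linarith [hx.2], by linarith [hx.1]⟩
        (by simpa using hxS)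
    have key := hS (1 - c) (1 - a) (by linarith) (by linarith) (by linarith) hd'
    have hsub : ContMDiff (J.prod 𝓘(ℝ, ℝ)) 𝓘(ℝ, ℝ) ∞ (fun z : N × ℝ => 1 - z.2) :=
      ((contDiff_const.sub contDiff_id : ContDiff ℝ ∞ (fun t : ℝ => 1 - t)).contMDiff).comp
        contMDiff_snd
    refine (key.comp (f := fun z : N × ℝ => (z.1, 1 - z.2))
      (contMDiff_fst.prodMk hsub).contMDiffOn
      (fun z hz => ⟨hz.1, by linarith [hz.2.2], by linarith [hz.2.1]⟩)).congr ?_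
    intro z hz
    have hz2 : z.2 ∈ Icc (0 : ℝ) 1 := ⟨h0.trans hz.2.1, hz.2.2.trans h1⟩
    have hz3 : 1 - z.2 ∈ Icc (0 : ℝ) 1 := ⟨by linarith [hz2.2], by linarith [hz2.1]⟩
    simp only [Function.comp]
    rw [IccExtend_of_mem _ _ hz2, IccExtend_of_mem _ _ hz3]
    rfl

theorem SmoothFamilyOn.pcomp {U : Set N} {α β : N → unitInterval → M} (hα : SmoothFamilyOn n J U α)
    (hβ : SmoothFamilyOn n J U β) (h : ∀ u ∈ U, β u 1 = α u 0) :
    SmoothFamilyOn n J U (fun u => α u ⊙ β u) := by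
  classical
  obtain ⟨hcα, S, hS⟩ := hα
  obtain ⟨hcβ, T, hT⟩ := hβ
  refine ⟨?_, insert (1 / 2) (S.image (fun s => (s + 1) / 2) ∪ T.image (fun s => s / 2)),
    fun a c h0 hac h1 hd => ?_⟩
  · rw [continuousOn_iff_continuous_domRestrict]
    have hp : Continuous (fun z : ↥(U ×ˢ (univ : Set unitInterval)) => z.1.1) := by fun_prop
    refine Continuous.if_le (f := fun z : ↥(U ×ˢ (univ : Set unitInterval)) => (z.1.2 : ℝ))
      (g := fun _ => (1 / 2 : ℝ))
      (f' := fun z => IccExtend zero_le_one (β z.1.1) (2 * (z.1.2 : ℝ)))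
      (g' := fun z => IccExtend zero_le_one (α z.1.1) (2 * (z.1.2 : ℝ) - 1)) ?_ ?_
      (by fun_prop) (by fun_prop) ?_
    · exact hcβ.comp_continuous
        (f := fun z : ↥(U ×ˢ (univ : Set unitInterval)) =>
          (z.1.1, projIcc (0 : ℝ) 1 zero_le_one (2 * (z.1.2 : ℝ))))
        (hp.prodMk (continuous_projIcc.comp (by fun_prop))) (fun z => ⟨z.2.1, trivial⟩)
    · exact hcα.comp_continuous
        (f := fun z : ↥(U ×ˢ (univ : Set unitInterval)) =>
          (z.1.1, projIcc (0 : ℝ) 1 zero_le_one (2 * (z.1.2 : ℝ) - 1)))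
        (hp.prodMk (continuous_projIcc.comp (by fun_prop))) (fun z => ⟨z.2.1, trivial⟩)
    · intro z hz
      rw [hz]
      have e1 : IccExtend zero_le_one (β z.1.1) (2 * (1 / 2 : ℝ)) = β z.1.1 1 := by
        norm_num
      have e2 : IccExtend zero_le_one (α z.1.1) (2 * (1 / 2 : ℝ) - 1) = α z.1.1 0 := by
        norm_num
      rw [e1, e2]; exact h _ z.2.1
  · rw [Set.disjoint_left] at hd
    rcases le_or_gt c (1 / 2) with hc | hc
    · have hd' : Disjoint (Ioo (2 * a) (2 * c)) (T : Set ℝ) := by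
        rw [Set.disjoint_left]
        intro x hx hxS
        refine hd (a := x / 2) ⟨by linarith [hx.1], by linarith [hx.2]⟩ ?_
        simp only [Finset.coe_insert, Finset.coe_union, Finset.coe_image]
        exact Or.inr (Or.inr ⟨x, hxS, rfl⟩)
      have key := hT (2 * a) (2 * c) (by linarith) (by linarith) (by linarith) hd'
      have hsub : ContMDiff (J.prod 𝓘(ℝ, ℝ)) 𝓘(ℝ, ℝ) ∞ (fun z : N × ℝ => 2 * z.2) :=
        ((contDiff_const.mul contDiff_id : ContDiff ℝ ∞ (fun t : ℝ => 2 * t)).contMDiff).comp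
          contMDiff_snd
      refine (key.comp (f := fun z : N × ℝ => (z.1, 2 * z.2))
        (contMDiff_fst.prodMk hsub).contMDiffOn
        (fun z hz => ⟨hz.1, by linarith [hz.2.1], by linarith [hz.2.2]⟩)).congr ?_
      intro z hz
      have hz2 : z.2 ∈ Icc (0 : ℝ) 1 := ⟨h0.trans hz.2.1, hz.2.2.trans h1⟩
      simp only [Function.comp]
      rw [IccExtend_of_mem _ _ hz2]
      simp only [LoopHolonomy.pcomp]
      rw [if_pos (hz.2.2.trans hc)]
    · have ha : 1 / 2 ≤ a := by
        by_contra! hne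
        exact hd (a := 1 / 2) ⟨hne, hc⟩ (by simp)
      have hd' : Disjoint (Ioo (2 * a - 1) (2 * c - 1)) (S : Set ℝ) := by
        rw [Set.disjoint_left]
        intro x hx hxS
        refine hd (a := (x + 1) / 2) ⟨by linarith [hx.1], by linarith [hx.2]⟩ ?_
        simp only [Finset.coe_insert, Finset.coe_union, Finset.coe_image]
        exact Or.inr (Or.inl ⟨x, hxS, rfl⟩)
      have key := hS (2 * a - 1) (2 * c - 1) (by linarith) (by linarith) (by linarith) hd'
      have hsub : ContMDiff (J.prod 𝓘(ℝ, ℝ)) 𝓘(ℝ, ℝ) ∞ (fun z : N × ℝ => 2 * z.2 - 1) :=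
        (((contDiff_const.mul contDiff_id).sub contDiff_const :
          ContDiff ℝ ∞ (fun t : ℝ => 2 * t - 1)).contMDiff).comp contMDiff_snd
      refine (key.comp (f := fun z : N × ℝ => (z.1, 2 * z.2 - 1))
        (contMDiff_fst.prodMk hsub).contMDiffOn
        (fun z hz => ⟨hz.1, by linarith [hz.2.1], by linarith [hz.2.2]⟩)).congr ?_
      intro z hz
      have hz2 : z.2 ∈ Icc (0 : ℝ) 1 := ⟨h0.trans hz.2.1, hz.2.2.trans h1⟩
      simp only [Function.comp]
      rw [IccExtend_of_mem _ _ hz2]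
      simp only [LoopHolonomy.pcomp]
      split_ifs with h12
      · have : z.2 = 1 / 2 := le_antisymm h12 (ha.trans hz.2.1)
        rw [this]
        have e1 : IccExtend zero_le_one (β z.1) (2 * (1 / 2 : ℝ)) = β z.1 1 := by
          norm_num
        have e2 : IccExtend zero_le_one (α z.1) (2 * (1 / 2 : ℝ) - 1) = α z.1 0 := by
          norm_num
        rw [e1, e2]; exact h _ hz.1
      · rfl

theorem PiecewiseSmooth.pcomp {α β : unitInterval → M} (hα : PiecewiseSmooth n α)
    (hβ : PiecewiseSmooth n β) (h : β 1 = α 0) : PiecewiseSmooth n (α ⊙ β) :=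
  ((SmoothFamilyOn.const (J := 𝓘(ℝ, ℝ)) hα (univ : Set ℝ)).pcomp (SmoothFamilyOn.const hβ univ)
    (fun _ _ => h)).piecewiseSmooth (mem_univ 0)

theorem PiecewiseSmooth.pinv {α : unitInterval → M} (hα : PiecewiseSmooth n α) :
    PiecewiseSmooth n (pinv α) :=
  (SmoothFamilyOn.const (J := 𝓘(ℝ, ℝ)) hα (univ : Set ℝ)).pinv.piecewiseSmooth (mem_univ 0)

theorem PiecewiseSmooth.const (x : M) : PiecewiseSmooth n (fun _ : unitInterval => x) :=
  ⟨continuous_const, ∅, fun _ _ _ _ _ _ => contMDiffOn_const⟩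

theorem PiecewiseSmooth.contr {p : unitInterval → M} (hp : PiecewiseSmooth n p) (i : unitInterval) :
    PiecewiseSmooth n (contr p i) := by
  classical
  by_cases hi : (i : ℝ) = 0
  · have hi' : i = 0 := Subtype.ext hi
    have : LoopHolonomy.contr p i = fun _ : unitInterval => p 0 := by
      funext j; simp [LoopHolonomy.contr, hi']
    rw [this]; exact PiecewiseSmooth.const _
  have hpos : 0 < (i : ℝ) := lt_of_le_of_ne i.2.1 (Ne.symm hi)
  obtain ⟨hc, S, hS⟩ := hp
  refine ⟨hc.comp (by fun_prop), S.image (fun s => s / (i : ℝ)), fun a c h0 hac h1 hd => ?_⟩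
  have hd' : Disjoint (Ioo (i * a) (i * c)) (S : Set ℝ) := by
    rw [Set.disjoint_left] at hd ⊢
    intro x hx hxS
    refine hd (a := x / i) ⟨?_, ?_⟩ (by
      simp only [Finset.coe_image]
      exact ⟨x, hxS, rfl⟩)
    · rw [lt_div_iff₀ hpos]; linarith [hx.1]
    · rw [div_lt_iff₀ hpos]; linarith [hx.2]
  have hi1 := i.2.2
  have key := hS (i * a) (i * c) (by positivity) (by gcongr) (by nlinarith) hd'
  have hsub : ContMDiff 𝓘(ℝ, ℝ) 𝓘(ℝ, ℝ) ∞ (fun t : ℝ => (i : ℝ) * t) :=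
    (contDiff_const.mul contDiff_id : ContDiff ℝ ∞ (fun t : ℝ => (i : ℝ) * t)).contMDiff
  refine (key.comp hsub.contMDiffOn
    (fun t ht => ⟨by simpa using mul_le_mul_of_nonneg_left ht.1 hpos.le,
      by simpa using mul_le_mul_of_nonneg_left ht.2 hpos.le⟩)).congr ?_
  intro t ht
  have ht2 : t ∈ Icc (0 : ℝ) 1 := ⟨h0.trans ht.1, ht.2.trans h1⟩
  have ht3 : (i : ℝ) * t ∈ Icc (0 : ℝ) 1 :=
    ⟨mul_nonneg hpos.le ht2.1, by nlinarith [ht2.1, ht2.2]⟩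
  simp only [Function.comp]
  rw [IccExtend_of_mem _ _ ht2, IccExtend_of_mem _ _ ht3]
  rfl

end Families

section Thin

variable {M : Type*}

theorem pcomp_range {α β : unitInterval → M} (h : β 1 = α 0) : range (α ⊙ β) = range α ∪ range β := by
  apply Subset.antisymm
  · rintro _ ⟨t, rfl⟩
    simp only [pcomp]
    split_ifs
    · exact Or.inr ⟨_, rfl⟩
    · exact Or.inl ⟨_, rfl⟩
  · rintro _ (⟨t, rfl⟩ | ⟨t, rfl⟩)
    · by_cases ht : (t : ℝ) = 0
      · have ht' : t = 0 := Subtype.ext ht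
        refine ⟨⟨1 / 2, by norm_num⟩, ?_⟩
        subst ht'
        simp [pcomp, h]
      · have hpos : 0 < (t : ℝ) := lt_of_le_of_ne t.2.1 (Ne.symm ht)
        refine ⟨⟨(t + 1) / 2, by linarith [t.2.1], by linarith [t.2.2]⟩, ?_⟩
        have : ¬ (((t : ℝ) + 1) / 2 ≤ 1 / 2) := by linarith
        simp only [pcomp]
        rw [if_neg this]
        have e : 2 * (((t : ℝ) + 1) / 2) - 1 = t := by ring
        rw [e]; simp
    · refine ⟨⟨t / 2, by linarith [t.2.1], by linarith [t.2.2]⟩, ?_⟩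
      have : (t : ℝ) / 2 ≤ 1 / 2 := by linarith [t.2.2]
      simp only [pcomp]
      rw [if_pos this]
      have e : 2 * ((t : ℝ) / 2) = t := by ring
      rw [e]; simp

theorem pinv_range (α : unitInterval → M) : range (pinv α) = range α := by
  apply Subset.antisymm
  · rintro _ ⟨t, rfl⟩; exact ⟨_, rfl⟩
  · rintro _ ⟨t, rfl⟩; exact ⟨unitInterval.symm t, by simp [pinv]⟩

@[simp] theorem pcomp_zero (α β : unitInterval → M) : (α ⊙ β) 0 = β 0 := by simp [pcomp]
@[simp] theorem pcomp_one (α β : unitInterval → M) : (α ⊙ β) 1 = α 1 := by norm_num [pcomp]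
@[simp] theorem pinv_zero (α : unitInterval → M) : pinv α 0 = α 1 := by simp [pinv]
@[simp] theorem pinv_one (α : unitInterval → M) : pinv α 1 = α 0 := by simp [pinv]

variable [TopologicalSpace M]

/-- A loop `γ` is thin if there is a homotopy of loops from `γ` to the constant loop whose image
lies in the image of `γ`. -/
def IsThin (γ : unitInterval → M) : Prop :=
  ∃ h : unitInterval × unitInterval → M, Continuous h ∧ (∀ t, h (0, t) = γ t) ∧ (∀ t, h (1, t) = γ 0) ∧
    (∀ s, h (s, 0) = γ 0 ∧ h (s, 1) = γ 0) ∧ range h ⊆ range γ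

theorem isThin_of_homotopic {R : Set M} {x : R} (L : Path x x)
    (hL : L.Homotopic (Path.refl x)) {γ : unitInterval → M} (hγ : ∀ t, γ t = (L t : M))
    (hR : R ⊆ range γ) : IsThin γ := by
  obtain ⟨h⟩ := hL
  refine ⟨fun z => (h z : M), by fun_prop, fun t => by simp [hγ], fun t => by simp [hγ],
    fun s => by simp [hγ], ?_⟩
  rintro _ ⟨z, rfl⟩
  exact hR (h z).2

/-- A path with values in `R` as a path in the subspace `R`. -/
def liftPath {R : Set M} (p : unitInterval → M) (hp : Continuous p) (hR : ∀ t, p t ∈ R) :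
    Path (⟨p 0, hR 0⟩ : R) ⟨p 1, hR 1⟩ where
  toFun t := ⟨p t, hR t⟩
  continuous_toFun := by fun_prop
  source' := rfl
  target' := rfl

theorem coe_trans {R : Set M} {x y z : R} (P : Path x y) (Q : Path y z) :
    (fun t => ((P.trans Q t : R) : M)) = (fun s => (Q s : M)) ⊙ (fun s => (P s : M)) := by
  funext t
  simp only [pcomp, Path.trans_apply]
  by_cases h : (t : ℝ) ≤ 1 / 2
  · rw [dif_pos h, if_pos h, IccExtend_of_mem]
  · rw [dif_neg h, if_neg h, IccExtend_of_mem]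

/-- Retracing: `p⁻¹ ∘ p` is thin. -/
theorem isThin_pinv_pcomp {p : unitInterval → M} (hp : Continuous p) : IsThin (pinv p ⊙ p) := by
  let P := liftPath (R := range p) p hp (fun t => ⟨t, rfl⟩)
  refine isThin_of_homotopic (P.trans P.symm) ?_ (fun t => ?_) ?_
  · rw [← Path.Homotopic.Quotient.eq]; simp
  · exact (congrFun (coe_trans P P.symm) t).symm
  · rw [pcomp_range (by simp), pinv_range, union_self]

theorem isThin_triangle {p q r : unitInterval → M} (hp : Continuous p) (hq : Continuous q)
    (hr : Continuous r) (h0q : q 0 = p 0) (h0r : r 0 = p 0) (h1q : q 1 = p 1) (h1r : r 1 = p 1) :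
    IsThin (pinv (pinv p ⊙ r) ⊙ ((pinv p ⊙ q) ⊙ (pinv q ⊙ r))) := by
  let R := range p ∪ range q ∪ range r
  let P := liftPath (R := R) p hp (fun t => Or.inl (Or.inl ⟨t, rfl⟩))
  let Q := (liftPath (R := R) q hq (fun t => Or.inl (Or.inr ⟨t, rfl⟩))).cast
    (x' := ⟨p 0, Or.inl (Or.inl ⟨0, rfl⟩)⟩) (y' := ⟨p 1, Or.inl (Or.inl ⟨1, rfl⟩)⟩)
    (Subtype.ext h0q.symm) (Subtype.ext h1q.symm)
  let S := (liftPath (R := R) r hr (fun t => Or.inr ⟨t, rfl⟩)).cast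
    (x' := ⟨p 0, Or.inl (Or.inl ⟨0, rfl⟩)⟩) (y' := ⟨p 1, Or.inl (Or.inl ⟨1, rfl⟩)⟩)
    (Subtype.ext h0r.symm) (Subtype.ext h1r.symm)
  refine isThin_of_homotopic (((S.trans Q.symm).trans (Q.trans P.symm)).trans
    (S.trans P.symm).symm) ?_ (fun t => ?_) ?_
  · rw [← Path.Homotopic.Quotient.eq]
    simp only [Path.Homotopic.Quotient.mk_trans, Path.Homotopic.Quotient.mk_symm,
      Path.Homotopic.Quotient.mk_refl]
    rw [Path.Homotopic.Quotient.trans_assoc (Path.Homotopic.Quotient.mk S) _ _,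
      ← Path.Homotopic.Quotient.trans_assoc _ (Path.Homotopic.Quotient.mk Q) _,
      Path.Homotopic.Quotient.symm_trans, Path.Homotopic.Quotient.refl_trans,
      Path.Homotopic.Quotient.trans_symm]
  · have e1 := coe_trans S Q.symm
    have e2 := coe_trans Q P.symm
    have e3 := coe_trans S P.symm
    have e4 := coe_trans (S.trans Q.symm) (Q.trans P.symm)
    rw [e1, e2] at e4
    have e5 := coe_trans ((S.trans Q.symm).trans (Q.trans P.symm)) (S.trans P.symm).symm
    have e6 : (fun s => (((S.trans P.symm).symm s : R) : M)) =
      pinv (fun s => ((S.trans P.symm s : R) : M)) := rfl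
    rw [e4, e6, e3] at e5
    exact (congrFun e5 t).symm
  · have h1 : (pinv q ⊙ r) 1 = (pinv p ⊙ q) 0 := by simp
    have h2 : ((pinv p ⊙ q) ⊙ (pinv q ⊙ r)) 1 = pinv (pinv p ⊙ r) 0 := by simp
    rw [pcomp_range h2, pinv_range, pcomp_range h1, pcomp_range (by simp [h1r]),
      pcomp_range (by simp [h1q]), pcomp_range (by simp [h1q, h1r]), pinv_range, pinv_range]
    intro x hx
    simp only [R, mem_union] at hx ⊢
    tauto

end Thin


section Holonomy

variable (n d : ℕ) {M : Type*} [TopologicalSpace M] [ChartedSpace (Euc n) M] (b : M)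

/-- The space `PM` of piecewise smooth paths starting at the base point. -/
structure BasedPath where
  toFun : unitInterval → M
  smooth : PiecewiseSmooth n toFun
  source : toFun 0 = b

/-- The space `ΩM` of piecewise smooth loops at the base point. -/
structure BasedLoop extends BasedPath n b where
  target : toFun 1 = b

instance : CoeFun (BasedPath n b) (fun _ => unitInterval → M) := ⟨BasedPath.toFun⟩
instance : CoeFun (BasedLoop n b) (fun _ => unitInterval → M) := ⟨fun γ => γ.toFun⟩

/-- The constant path. -/
def constPath : BasedPath n b := ⟨fun _ => b, PiecewiseSmooth.const b, rfl⟩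

variable {n b}

/-- The composition `α ∘ β` of loops (first `β`, then `α`). -/
noncomputable def BasedLoop.comp (α β : BasedLoop n b) : BasedLoop n b where
  toFun := α ⊙ β
  smooth := α.smooth.pcomp β.smooth (β.target.trans α.source.symm)
  source := by simpa using β.source
  target := by simpa using α.target

/-- `K(p,i)` as an element of `PM`. -/
def BasedPath.contr (p : BasedPath n b) (i : unitInterval) : BasedPath n b where
  toFun := LoopHolonomy.contr p i
  smooth := p.smooth.contr i
  source := by simpa [LoopHolonomy.contr] using p.source

variable (n b)

/-- The set of axiomatic holonomy maps `H : ΩM → G`. -/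
structure HolonomyMap (G : Type*) [Group G] [TopologicalSpace G] [ChartedSpace (Euc d) G] where
  toFun : BasedLoop n b → G
  map_comp : ∀ α β : BasedLoop n b, toFun (α.comp β) = toFun β * toFun α
  map_thin : ∀ α : BasedLoop n b, IsThin α → toFun α = 1
  smooth : ∀ (m : ℕ) (U : Set (Euc m)), IsOpen U → ∀ Ω : Euc m → BasedLoop n b,
    SmoothFamilyOn n (𝓡 m) U (fun u => (Ω u : unitInterval → M)) →
      ContMDiffOn (𝓡 m) (𝓡 d) ∞ (fun u => toFun (Ω u)) U

variable {n d b} {G : Type*} [Group G] [TopologicalSpace G] [ChartedSpace (Euc d) G]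

namespace HolonomyMap

variable (H : HolonomyMap n d b G)

open Classical in
/-- The value of `H` on a map `γ : [0,1] → M`; it is only meaningful (and set to `1` otherwise)
if `γ` is a piecewise smooth loop at the base point. -/
noncomputable def val (γ : unitInterval → M) : G :=
  if h : PiecewiseSmooth n γ ∧ γ 0 = b ∧ γ 1 = b then H.toFun ⟨⟨γ, h.1, h.2.1⟩, h.2.2⟩ else 1

theorem val_eq {γ : unitInterval → M} (h1 : PiecewiseSmooth n γ) (h2 : γ 0 = b) (h3 : γ 1 = b) :
    H.val γ = H.toFun ⟨⟨γ, h1, h2⟩, h3⟩ := by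
  simp [val, h1, h2, h3]

theorem val_pcomp {α β : unitInterval → M} (hα : PiecewiseSmooth n α) (hα0 : α 0 = b) (hα1 : α 1 = b)
    (hβ : PiecewiseSmooth n β) (hβ0 : β 0 = b) (hβ1 : β 1 = b) :
    H.val (α ⊙ β) = H.val β * H.val α := by
  rw [H.val_eq hα hα0 hα1, H.val_eq hβ hβ0 hβ1, ← H.map_comp,
    H.val_eq (hα.pcomp hβ (hβ1.trans hα0.symm)) (by simpa using hβ0) (by simpa using hα1)]
  rfl

theorem val_thin {α : unitInterval → M} (h : IsThin α) : H.val α = 1 := by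
  unfold val
  split_ifs with h'
  · exact H.map_thin _ h
  · rfl

theorem smooth_diff {p q : BasedPath n b} (h : q 1 = p 1) :
    PiecewiseSmooth n (pinv p ⊙ q) := p.smooth.pinv.pcomp q.smooth (by simpa using h)

theorem val_self (p : BasedPath n b) : H.val (pinv p ⊙ p) = 1 :=
  H.val_thin (isThin_pinv_pcomp p.smooth.1)

theorem val_trans {p q r : BasedPath n b} (hq : q 1 = p 1) (hr : r 1 = p 1) :
    H.val (pinv q ⊙ r) * H.val (pinv p ⊙ q) = H.val (pinv p ⊙ r) := by
  have hqr : PiecewiseSmooth n (pinv q ⊙ r) := smooth_diff (hr.trans hq.symm)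
  have hpq : PiecewiseSmooth n (pinv p ⊙ q) := smooth_diff hq
  have hpr : PiecewiseSmooth n (pinv p ⊙ r) := smooth_diff hr
  have hp0 := p.source
  have hq0 := q.source
  have hr0 := r.source
  have htri : PiecewiseSmooth n ((pinv p ⊙ q) ⊙ (pinv q ⊙ r)) :=
    hpq.pcomp hqr (by simp [hq0])
  have h1 := H.val_thin (isThin_triangle p.smooth.1 q.smooth.1 r.smooth.1 (hq0.trans hp0.symm)
    (hr0.trans hp0.symm) hq hr)
  have h2 := H.val_thin (isThin_pinv_pcomp hpr.1)
  rw [H.val_pcomp hpr.pinv (by simp [hp0]) (by simp [hr0]) htri (by simp [hr0])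
    (by simp [hp0]), H.val_pcomp hpq (by simp [hq0]) (by simp [hp0]) hqr (by simp [hr0])
    (by simp [hq0])] at h1
  rw [H.val_pcomp hpr.pinv (by simp [hp0]) (by simp [hr0]) hpr (by simp [hr0])
    (by simp [hp0])] at h2
  exact mul_right_cancel (h1.trans h2.symm)

/-- The equivalence relation `T` on `PM × G`: `(p,g) T (p',g')` iff `p(1) = p'(1)` and
`g' = H(p⁻¹ ∘ p') g`. -/
@[reducible] def setoid : Setoid (BasedPath n b × G) where
  r x y := x.1 1 = y.1 1 ∧ y.2 = H.val (pinv x.1 ⊙ y.1) * x.2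
  iseqv := by
    refine ⟨fun x => ⟨rfl, by simp [H.val_self]⟩, ?_, ?_⟩
    · rintro x y ⟨h1, h2⟩
      refine ⟨h1.symm, ?_⟩
      rw [h2, ← mul_assoc, H.val_trans h1.symm rfl, H.val_self, one_mul]
    · rintro x y z ⟨h1, h2⟩ ⟨h3, h4⟩
      refine ⟨h1.trans h3, ?_⟩
      rw [h4, h2, ← mul_assoc, H.val_trans h1.symm (h1.trans h3).symm]

/-- The total space `E = (PM × G)/T` of the reconstructed bundle. -/
def Total : Type _ := Quotient H.setoid

/-- The class `{p,g}`. -/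
def cls (p : BasedPath n b) (g : G) : H.Total := Quotient.mk H.setoid (p, g)

theorem cls_eq_cls {p p' : BasedPath n b} {g g' : G} :
    H.cls p g = H.cls p' g' ↔ p 1 = p' 1 ∧ g' = H.val (pinv p ⊙ p') * g := Quotient.eq

/-- The projection `π{p,g} = p(1)`. -/
def proj : H.Total → M :=
  Quotient.lift (fun x : BasedPath n b × G => x.1 1) (fun _ _ h => h.1)

/-- The right action `{p,h} g = {p,hg}`. -/
def act (a : H.Total) (g : G) : H.Total :=
  Quotient.map (fun x : BasedPath n b × G => (x.1, x.2 * g))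
    (fun x y h => ⟨And.left h, by
      have h2 : y.2 = H.val (pinv x.1 ⊙ y.1) * x.2 := And.right h
      simp only [h2, mul_assoc]⟩) a

theorem exists_rep (a : H.Total) : ∃ x : BasedPath n b × G, H.cls x.1 x.2 = a := by
  induction a using Quotient.ind with | _ x => exact ⟨x, rfl⟩

/-- A representative of a class. -/
noncomputable def rep (a : H.Total) : BasedPath n b × G := (H.exists_rep a).choose

theorem cls_rep (a : H.Total) : H.cls (H.rep a).1 (H.rep a).2 = a := (H.exists_rep a).choose_spec

end HolonomyMap

variable (n b)

/-- A smooth family of paths `ψ : U → PM` on an open set `U ⊆ M` with `ψ[u](1) = u`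
(the values of `toFun` outside `U` are irrelevant). -/
structure LocalFamily where
  U : Set M
  isOpen : IsOpen U
  toFun : M → BasedPath n b
  smooth : SmoothFamilyOn n (𝓡 n) U (fun u => (toFun u : unitInterval → M))
  tip : ∀ u ∈ U, toFun u 1 = u

instance : CoeFun (LocalFamily n b) (fun _ => M → BasedPath n b) := ⟨LocalFamily.toFun⟩


variable {n b}

namespace HolonomyMap

variable (H : HolonomyMap n d b G)

/-- The topology of `E`: the final topology for the local trivializations
`C_ψ : U × G → E`, `C_ψ(u,g) = {ψ[u],g}`. -/
instance : TopologicalSpace H.Total :=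
  ⨆ ψ : LocalFamily n b, TopologicalSpace.coinduced
    (fun z : ψ.U × G => H.cls (ψ z.1) z.2) inferInstance

/-- The second component of `C_ψ⁻¹`: `{p,g} ↦ H(p⁻¹ ∘ ψ[p(1)]) g`. -/
noncomputable def coord (ψ : LocalFamily n b) (a : H.Total) : G :=
  H.val (pinv (H.rep a).1 ⊙ (ψ (H.proj a) : unitInterval → M)) * (H.rep a).2

theorem coord_cls (ψ : LocalFamily n b) {p : BasedPath n b} (hp : p 1 ∈ ψ.U) (g : G) :
    H.coord ψ (H.cls p g) = H.val (pinv p ⊙ (ψ (p 1) : unitInterval → M)) * g := by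
  obtain ⟨h1, h2⟩ := H.cls_eq_cls.1 (H.cls_rep (H.cls p g))
  rw [coord]
  generalize H.rep (H.cls p g) = x at h1 h2
  subst h2
  rw [← mul_assoc, H.val_trans h1.symm]
  · rfl
  · rw [h1]; exact ψ.tip _ hp

theorem isOpen_proj_preimage (ψ : LocalFamily n b) : IsOpen (H.proj ⁻¹' ψ.U) := by
  refine isOpen_iSup_iff.2 (fun ψ' => isOpen_coinduced.2 ?_)
  have : (fun z : ψ'.U × G => H.cls (ψ' z.1) z.2) ⁻¹' (H.proj ⁻¹' ψ.U) =
      {z : ψ'.U × G | (z.1 : M) ∈ ψ.U} := by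
    ext z
    change ψ' z.1 1 ∈ ψ.U ↔ (z.1 : M) ∈ ψ.U
    rw [ψ'.tip _ z.1.2]
  rw [this]
  exact ψ.isOpen.preimage (by fun_prop)

end HolonomyMap

variable [IsManifold (𝓡 n) ∞ M]

theorem exists_segments (m : M) : ∃ U : Set M, IsOpen U ∧ m ∈ U ∧ ∃ σ : M → unitInterval → M,
    SmoothFamilyOn n (𝓡 n) U σ ∧ ∀ u ∈ U, σ u 0 = m ∧ σ u 1 = u := by
  let c := chartAt (Euc n) m
  obtain ⟨ε, hε, hball⟩ := Metric.isOpen_iff.1 c.open_target (c m) (mem_chart_target _ m)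
  have hsrc : ContMDiffOn (𝓡 n) (𝓡 n) ∞ c c.source := contMDiffOn_chart
  have htgt : ContMDiffOn (𝓡 n) (𝓡 n) ∞ c.symm c.target := contMDiffOn_chart_symm
  let U := c.source ∩ c ⁻¹' Metric.ball (c m) ε
  have hU : IsOpen U := c.isOpen_inter_preimage Metric.isOpen_ball
  let τ : M → ℝ → Euc n := fun u t => c m + t • (c u - c m)
  have hmem : ∀ u ∈ U, ∀ t ∈ Icc (0 : ℝ) 1, τ u t ∈ c.target := by
    intro u hu t ht
    refine hball ?_
    have h1 : ‖c u - c m‖ < ε := by rw [← dist_eq_norm]; exact hu.2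
    simp only [τ, Metric.mem_ball, dist_self_add_left, norm_smul, Real.norm_eq_abs,
      abs_of_nonneg ht.1]
    nlinarith [norm_nonneg (c u - c m), ht.1, ht.2]
  have hτ : ContMDiffOn ((𝓡 n).prod 𝓘(ℝ, ℝ)) (𝓡 n) ∞ (fun z : M × ℝ => τ z.1 z.2)
      (U ×ˢ univ) := by
    have hc : ContMDiffOn ((𝓡 n).prod 𝓘(ℝ, ℝ)) (𝓡 n) ∞ (fun z : M × ℝ => c z.1)
        (U ×ˢ univ) := hsrc.comp contMDiff_fst.contMDiffOn (fun z hz => hz.1.1)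
    have h2 : ContMDiffOn ((𝓡 n).prod 𝓘(ℝ, ℝ)) 𝓘(ℝ, ℝ) ∞ (fun z : M × ℝ => z.2)
        (U ×ˢ univ) := contMDiff_snd.contMDiffOn
    exact contMDiffOn_const.add (h2.smul (hc.sub contMDiffOn_const))
  refine ⟨U, hU, ⟨mem_chart_source _ m, Metric.mem_ball_self hε⟩,
    fun u t => c.symm (τ u t), ⟨?_, ∅, ?_⟩, ?_⟩
  · refine htgt.continuousOn.comp (f := fun z : M × unitInterval => τ z.1 z.2) ?_
      (fun z hz => hmem _ hz.1 _ z.2.2)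
    exact hτ.continuousOn.comp (f := fun z : M × unitInterval => (z.1, (z.2 : ℝ)))
      (by fun_prop) (fun z hz => ⟨hz.1, trivial⟩)
  · intro a e h0 _ h1 _
    have : ContMDiffOn ((𝓡 n).prod 𝓘(ℝ, ℝ)) (𝓡 n) ∞ (fun z : M × ℝ => c.symm (τ z.1 z.2))
        (U ×ˢ Icc a e) :=
      htgt.comp (hτ.mono (prod_mono Subset.rfl (subset_univ _)))
        (fun z hz => hmem _ hz.1 _ ⟨h0.trans hz.2.1, hz.2.2.trans h1⟩)
    refine this.congr (fun z hz => ?_)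
    rw [IccExtend_of_mem _ _ ⟨h0.trans hz.2.1, hz.2.2.trans h1⟩]
  · intro u hu
    refine ⟨?_, ?_⟩
    · simp [τ, c]
    · simp [τ, c.left_inv hu.1]

theorem exists_basedPath [ConnectedSpace M] (x : M) : ∃ p : BasedPath n b, p 1 = x := by
  let S : Set M := {x | ∃ p : BasedPath n b, p 1 = x}
  suffices h : S = univ by
    have : x ∈ S := h ▸ mem_univ x
    exact this
  refine IsClopen.eq_univ ⟨⟨?_⟩, ?_⟩ ⟨b, constPath n b, rfl⟩
  · rw [isOpen_iff_mem_nhds]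
    intro m hm
    obtain ⟨U, hU, hmU, σ, hσ, hend⟩ := exists_segments (n := n) m
    filter_upwards [hU.mem_nhds hmU] with u hu
    rintro ⟨p, hp⟩
    refine hm ⟨⟨pinv (σ u) ⊙ p, (hσ.piecewiseSmooth hu).pinv.pcomp p.smooth ?_, ?_⟩, ?_⟩
    · simp [hp, hend u hu]
    · simp [p.source]
    · simp [hend u hu]
  · rw [isOpen_iff_mem_nhds]
    rintro m ⟨p, hp⟩
    obtain ⟨U, hU, hmU, σ, hσ, hend⟩ := exists_segments (n := n) m
    filter_upwards [hU.mem_nhds hmU] with u hu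
    refine ⟨⟨σ u ⊙ p, (hσ.piecewiseSmooth hu).pcomp p.smooth ?_, ?_⟩, ?_⟩
    · simp [hp, hend u hu]
    · simp [p.source]
    · simp [hend u hu]

theorem exists_localFamily [ConnectedSpace M] (m : M) : ∃ ψ : LocalFamily n b, m ∈ ψ.U := by
  classical
  obtain ⟨p, hp⟩ := exists_basedPath (n := n) (b := b) m
  obtain ⟨U, hU, hmU, σ, hσ, hend⟩ := exists_segments (n := n) m
  have hfam : SmoothFamilyOn n (𝓡 n) U (fun u => σ u ⊙ (p : unitInterval → M)) :=
    hσ.pcomp (SmoothFamilyOn.const p.smooth U) (fun u hu => by simp [hp, hend u hu])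
  refine ⟨⟨U, hU, fun u => if hu : u ∈ U then
      ⟨σ u ⊙ p, hfam.piecewiseSmooth hu, by simp [p.source]⟩ else constPath n b, ?_, ?_⟩, hmU⟩
  · exact hfam.congr (fun u hu => by simp [hu])
  · intro u hu; simp [hu, hend u hu]

namespace HolonomyMap

variable (H : HolonomyMap n d b G)

theorem contMDiffOn_val {U : Set M} (hU : IsOpen U) {w : M → unitInterval → M}
    (hw : SmoothFamilyOn n (𝓡 n) U w) (h0 : ∀ u ∈ U, w u 0 = b) (h1 : ∀ u ∈ U, w u 1 = b) :
    ContMDiffOn (𝓡 n) (𝓡 d) ∞ (fun u => H.val (w u)) U := by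
  classical
  intro x hx
  let c := chartAt (Euc n) x
  let V : Set (Euc n) := c.target ∩ c.symm ⁻¹' U
  have hV : IsOpen V := c.isOpen_inter_preimage_symm hU
  have hfam : SmoothFamilyOn n (𝓡 n) V (fun v => w (c.symm v)) :=
    hw.comp ((contMDiffOn_chart_symm (I := 𝓡 n) (n := ∞) (x := x)).mono inter_subset_left)
      (fun v hv => hv.2)
  let Ω : Euc n → BasedLoop n b := fun v =>
    if hv : v ∈ V then ⟨⟨w (c.symm v), hfam.piecewiseSmooth hv, h0 _ hv.2⟩, h1 _ hv.2⟩
    else ⟨constPath n b, rfl⟩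
  have hΩ : ∀ v ∈ V, (Ω v : unitInterval → M) = w (c.symm v) := fun v hv => by simp [Ω, hv]
  have key := H.smooth n V hV Ω (hfam.congr hΩ)
  have key2 : ContMDiffOn (𝓡 n) (𝓡 d) ∞ (fun v => H.val (w (c.symm v))) V := by
    refine key.congr (fun v hv => ?_)
    rw [H.val_eq (hfam.piecewiseSmooth hv) (h0 _ hv.2) (h1 _ hv.2)]
    simp [Ω, hv]
  have hW : c.source ∩ U ∈ 𝓝 x := (c.open_source.inter hU).mem_nhds ⟨mem_chart_source _ x, hx⟩
  have key3 : ContMDiffOn (𝓡 n) (𝓡 d) ∞ (fun u => H.val (w (c.symm (c u)))) (c.source ∩ U) := by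
    refine key2.comp ((contMDiffOn_chart (I := 𝓡 n) (n := ∞) (x := x)).mono inter_subset_left) ?_
    intro u hu
    exact ⟨c.map_source hu.1, by simpa [c.left_inv hu.1] using hu.2⟩
  have key4 : ContMDiffOn (𝓡 n) (𝓡 d) ∞ (fun u => H.val (w u)) (c.source ∩ U) :=
    key3.congr (fun u hu => by rw [c.left_inv hu.1])
  exact (key4.contMDiffAt hW).contMDiffWithinAt

theorem contMDiffOn_transition (ψ ψ' : LocalFamily n b) :
    ContMDiffOn (𝓡 n) (𝓡 d) ∞ (fun x => H.val (pinv (ψ x) ⊙ (ψ' x : unitInterval → M))) (ψ.U ∩ ψ'.U) := by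
  have h1 := ψ.smooth.mono (inter_subset_left (t := ψ'.U))
  have h2 := ψ'.smooth.mono (inter_subset_right (s := ψ.U))
  refine H.contMDiffOn_val (ψ.isOpen.inter ψ'.isOpen) (h1.pinv.pcomp h2 ?_) ?_ ?_
  · intro u hu; simp [ψ.tip u hu.1, ψ'.tip u hu.2]
  · intro u hu; simp [(ψ' u).source]
  · intro u hu; simp [(ψ u).source]

variable [LieGroup (𝓡 d) ∞ G]

/-- The inverse `C_ψ⁻¹ : π⁻¹(U) → U × G` of a local trivialization `C_ψ(u,g) = {ψ[u],g}`. -/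
noncomputable def localTriv (ψ : LocalFamily n b) : OpenPartialHomeomorph H.Total (M × G) where
  toFun a := (H.proj a, H.coord ψ a)
  invFun z := H.cls (ψ z.1) z.2
  source := H.proj ⁻¹' ψ.U
  target := ψ.U ×ˢ univ
  map_source' a ha := ⟨ha, trivial⟩
  map_target' z hz := by
    change ψ z.1 1 ∈ ψ.U
    rw [ψ.tip _ hz.1]; exact hz.1
  left_inv' a ha := by
    obtain ⟨⟨p, g⟩, rfl⟩ := H.exists_rep a
    have hp : p 1 ∈ ψ.U := ha
    rw [H.coord_cls ψ hp]
    refine (H.cls_eq_cls.2 ⟨(ψ.tip _ hp).symm, rfl⟩).symm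
  right_inv' z hz := by
    have h1 : ψ z.1 1 = z.1 := ψ.tip _ hz.1
    have h2 : H.proj (H.cls (ψ z.1) z.2) = z.1 := h1
    refine Prod.ext h2 ?_
    change H.coord ψ (H.cls (ψ z.1) z.2) = z.2
    rw [H.coord_cls ψ (by rw [h1]; exact hz.1), h1, H.val_self, one_mul]
  open_source := H.isOpen_proj_preimage ψ
  open_target := ψ.isOpen.prod isOpen_univ
  continuousOn_toFun := by
    have : ContMDiffMul (𝓡 d) ∞ G := inferInstance
    have : ContinuousMul G := continuousMul_of_contMDiffMul (𝓡 d) ∞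
    have hsrc : IsOpen (H.proj ⁻¹' ψ.U) := H.isOpen_proj_preimage ψ
    refine (continuousOn_open_iff hsrc).2 fun s hs => ?_
    refine isOpen_iSup_iff.2 (fun ψ' => isOpen_coinduced.2 ?_)
    have hc : ContinuousOn (fun z : ψ'.U × G =>
        ((z.1 : M), H.val (pinv (ψ' z.1) ⊙ (ψ z.1 : unitInterval → M)) * z.2))
        {z : ψ'.U × G | (z.1 : M) ∈ ψ.U} := by
      refine ContinuousOn.prodMk (by fun_prop) (ContinuousOn.mul ?_ (by fun_prop))
      exact (H.contMDiffOn_transition ψ' ψ).continuousOn.comp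
        (f := fun z : ψ'.U × G => (z.1 : M)) (by fun_prop) (fun z hz => ⟨z.1.2, hz⟩)
    have ho : IsOpen {z : ψ'.U × G | (z.1 : M) ∈ ψ.U} := ψ.isOpen.preimage (by fun_prop)
    convert hc.isOpen_inter_preimage ho hs using 1
    ext z
    have e1 : ψ' z.1 1 = z.1 := ψ'.tip _ z.1.2
    have e2 : H.proj (H.cls (ψ' z.1) z.2) = z.1 := e1
    simp only [mem_inter_iff, mem_preimage, mem_ofPred_eq, e2]
    refine and_congr_right fun hz => ?_
    rw [H.coord_cls ψ (by rw [e1]; exact hz), e1]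
  continuousOn_invFun := by
    have hc : Continuous (fun z : ψ.U × G => H.cls (ψ z.1) z.2) :=
      continuous_iff_coinduced_le.2
        (le_iSup (fun ψ : LocalFamily n b => TopologicalSpace.coinduced
          (fun z : ψ.U × G => H.cls (ψ z.1) z.2) inferInstance) ψ)
    rw [continuousOn_iff_continuous_domRestrict]
    exact hc.comp (f := fun z : ↥(ψ.U ×ˢ (univ : Set G)) => ((⟨z.1.1, z.2.1⟩ : ψ.U), z.1.2))
      (by fun_prop)


/-- The differential structure of `E`: its charts are the inverses of the local trivializations
followed by the charts of `M × G`. -/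
noncomputable instance [ConnectedSpace M] :
    ChartedSpace (ModelProd (Euc n) (Euc d)) H.Total where
  atlas := {e | ∃ ψ : LocalFamily n b, ∃ c ∈ atlas (ModelProd (Euc n) (Euc d)) (M × G),
    e = H.localTriv ψ ≫ₕ c}
  chartAt a := H.localTriv (exists_localFamily (n := n) (b := b) (H.proj a)).choose ≫ₕ
    chartAt (ModelProd (Euc n) (Euc d))
      (H.localTriv (exists_localFamily (n := n) (b := b) (H.proj a)).choose a)
  mem_chart_source a := by
    rw [OpenPartialHomeomorph.trans_source]
    exact ⟨(exists_localFamily (n := n) (b := b) (H.proj a)).choose_spec,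
      mem_chart_source (ModelProd (Euc n) (Euc d)) (H.localTriv _ a)⟩
  chart_mem_atlas a := ⟨_, _, chart_mem_atlas _ _, rfl⟩

theorem contMDiffOn_localTriv_trans (ψ ψ' : LocalFamily n b) :
    ContMDiffOn ((𝓡 n).prod (𝓡 d)) ((𝓡 n).prod (𝓡 d)) ∞
      ((H.localTriv ψ).symm ≫ₕ H.localTriv ψ') ((H.localTriv ψ).symm ≫ₕ H.localTriv ψ').source := by
  have hs : ((H.localTriv ψ).symm ≫ₕ H.localTriv ψ').source ⊆ (ψ.U ∩ ψ'.U) ×ˢ univ := by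
    rw [OpenPartialHomeomorph.trans_source]
    rintro z ⟨h1, h2⟩
    have h1' : z.1 ∈ ψ.U := h1.1
    have h2' : ψ z.1 1 ∈ ψ'.U := h2
    rw [ψ.tip _ h1'] at h2'
    exact ⟨⟨h1', h2'⟩, trivial⟩
  have h : ContMDiffOn ((𝓡 n).prod (𝓡 d)) ((𝓡 n).prod (𝓡 d)) ∞
      (fun z : M × G => (z.1, H.val (pinv (ψ z.1) ⊙ (ψ' z.1 : unitInterval → M)) * z.2))
      ((ψ.U ∩ ψ'.U) ×ˢ univ) := by
    refine contMDiff_fst.contMDiffOn.prodMk (ContMDiffOn.mul ?_ contMDiff_snd.contMDiffOn)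
    exact (H.contMDiffOn_transition ψ ψ').comp (f := fun z : M × G => z.1)
      contMDiff_fst.contMDiffOn (fun z hz => hz.1)
  refine (h.mono hs).congr (fun z hz => ?_)
  have hz' := (hs hz).1
  have e1 : ψ z.1 1 = z.1 := ψ.tip _ hz'.1
  refine Prod.ext e1 ?_
  change H.coord ψ' (H.cls (ψ z.1) z.2) = _
  rw [H.coord_cls ψ' (by rw [e1]; exact hz'.2), e1]

instance [ConnectedSpace M] : IsManifold ((𝓡 n).prod (𝓡 d)) ∞ H.Total := by
  have : ContMDiffMul (𝓡 d) ∞ G := inferInstance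
  have : IsManifold (𝓡 d) ∞ G := this.toIsManifold
  refine isManifold_of_contDiffOn _ _ _ ?_
  rintro _ _ ⟨ψ, c, hc, rfl⟩ ⟨ψ', c', hc', rfl⟩
  have h1 := contMDiffOn_symm_of_mem_maximalAtlas (I := (𝓡 n).prod (𝓡 d)) (n := ∞)
    (StructureGroupoid.subset_maximalAtlas _ hc)
  have h2 := contMDiffOn_of_mem_maximalAtlas (I := (𝓡 n).prod (𝓡 d)) (n := ∞)
    (StructureGroupoid.subset_maximalAtlas _ hc')
  have h3 := H.contMDiffOn_localTriv_trans ψ ψ'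
  have h4 : ContMDiffOn ((𝓡 n).prod (𝓡 d)) ((𝓡 n).prod (𝓡 d)) ∞
      ((H.localTriv ψ ≫ₕ c).symm ≫ₕ (H.localTriv ψ' ≫ₕ c'))
      ((H.localTriv ψ ≫ₕ c).symm ≫ₕ (H.localTriv ψ' ≫ₕ c')).source := by
    refine h2.comp (h3.comp (h1.mono ?_) ?_) ?_
    · intro z hz
      simp only [mfld_simps] at hz ⊢
      tauto
    · intro z hz
      simp only [mfld_simps] at hz ⊢
      tauto
    · intro z hz
      simp only [mfld_simps] at hz ⊢
      tauto
  rw [← contMDiffOn_iff_contDiffOn]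
  refine ((𝓡 n).prod (𝓡 d)).contMDiff.comp_contMDiffOn
    (h4.comp (((𝓡 n).prod (𝓡 d)).contMDiffOn_symm.mono inter_subset_right) ?_)
  intro z hz
  exact hz.1

variable [ConnectedSpace M]

/-- The velocity `d/di c(i)` at `i = j` of a curve in `E`. -/
noncomputable def velocity (c : ℝ → H.Total) (j : ℝ) :
    TangentSpace ((𝓡 n).prod (𝓡 d)) (c j) :=
  mfderiv 𝓘(ℝ, ℝ) ((𝓡 n).prod (𝓡 d)) c j (1 : ℝ)

/-- The vertical subspace `ker π_*` of `T_a E`. -/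
noncomputable def vertical (a : H.Total) :
    Submodule ℝ (TangentSpace ((𝓡 n).prod (𝓡 d)) a) :=
  LinearMap.ker (mfderiv ((𝓡 n).prod (𝓡 d)) (𝓡 n) H.proj a).toLinearMap

/-- The subspace `Γ_a` of `T_a E` generated by the vectors `d/di {K(r,i),h}` at `i = j`, where
`r ∈ PM` is smooth near `0 < j < 1` and `{K(r,j),h} = a`. For `a = {p,g}` the last condition says
that `r(j) = p(1)` and `h = H(p⁻¹ ∘ K(r,j)) g`. -/
noncomputable def horizontal (a : H.Total) :
    Submodule ℝ (TangentSpace ((𝓡 n).prod (𝓡 d)) a) :=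
  Submodule.span ℝ {X | ∃ (r : BasedPath n b) (j : ℝ) (h : G), j ∈ Ioo (0 : ℝ) 1 ∧
    (∀ᶠ t in 𝓝 j, ContMDiffAt 𝓘(ℝ, ℝ) (𝓡 n) ∞ (IccExtend zero_le_one (r : unitInterval → M)) t) ∧
    H.cls (r.contr (projIcc 0 1 zero_le_one j)) h = a ∧
    X = H.velocity (fun i => H.cls (r.contr (projIcc 0 1 zero_le_one i)) h) j}

open Classical in
/-- The projection `P_V` of `T_a E` onto the vertical subspace along `Γ_a`; it is meaningful
(and set to `0` otherwise) if these two subspaces are complementary. -/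
noncomputable def vertProj (a : H.Total) (X : TangentSpace ((𝓡 n).prod (𝓡 d)) a) :
    TangentSpace ((𝓡 n).prod (𝓡 d)) a :=
  if h : IsCompl (H.vertical a) (H.horizontal a) then
    ((H.vertical a).projectionOnto (H.horizontal a) h X : H.vertical a) else 0

/-- The differential at `e` of the map `G → E`, `g ↦ ag`. -/
noncomputable def orbitDeriv (a : H.Total) (ξ : GroupLieAlgebra (𝓡 d) G) :
    TangentSpace ((𝓡 n).prod (𝓡 d)) a :=
  mfderiv (𝓡 d) ((𝓡 n).prod (𝓡 d)) (fun g : G => H.act a g) 1 ξ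

/-- The connection 1-form `ω_a X = (a⁻¹)_* P_V X`. Since `a⁻¹` is the inverse of the
diffeomorphism `G → π⁻¹(π(a))`, `g ↦ ag`, its differential is the inverse of `orbitDeriv a`. -/
noncomputable def connForm (a : H.Total) (X : TangentSpace ((𝓡 n).prod (𝓡 d)) a) :
    GroupLieAlgebra (𝓡 d) G :=
  Function.invFun (H.orbitDeriv a) (H.vertProj a X)

/-- The local section `σ(x) = C_ψ(x,e)`. -/
def localSection (ψ : LocalFamily n b) (x : M) : H.Total := H.cls (ψ x) 1

/-- The local coefficient `A_μ(x) = ω_{σ(x)} (σ_* ∂_μ(x))`, where `∂_μ` is the coordinate vector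
field of the chart `φ`. -/
noncomputable def localCoeff (ψ : LocalFamily n b) (φ : OpenPartialHomeomorph M (Euc n))
    (μ : Fin n) (x : M) : GroupLieAlgebra (𝓡 d) G :=
  H.connForm (H.localSection ψ x)
    (mfderiv (𝓡 n) ((𝓡 n).prod (𝓡 d)) (H.localSection ψ) x
      (mfderiv (𝓡 n) (𝓡 n) φ.symm (φ x) (EuclideanSpace.single μ (1 : ℝ))))

end HolonomyMap

/-- The curve `i ↦ (χ[i],g(i))` in `PM × G` on `[0,1]` has a piecewise smooth curve of end points
`i ↦ χ[i](1)`, and it is smooth near the interior parameter `j`. -/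
def SmoothNear (d : ℕ) {G : Type*} [TopologicalSpace G] [ChartedSpace (Euc d) G]
    (χ : ℝ → BasedPath n b) (g : ℝ → G) (j : ℝ) : Prop :=
  j ∈ Ioo (0 : ℝ) 1 ∧ PiecewiseSmooth n (fun i : unitInterval => χ i 1) ∧
  ∃ V : Set ℝ, IsOpen V ∧ j ∈ V ∧
    SmoothFamilyOn n 𝓘(ℝ, ℝ) V (fun i => (χ i : unitInterval → M)) ∧
    ContMDiffOn 𝓘(ℝ, ℝ) (𝓡 d) ∞ g V

/-- The straight segment `T_{y,x}(i) = x + i(y - x)` in the coordinates `φ`. -/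
noncomputable def straightPath (φ : OpenPartialHomeomorph M (Euc n)) (y x : Euc n) :
    unitInterval → M := fun i => φ.symm (x + (i : ℝ) • (y - x))

end Holonomy

end LoopHolonomy

open LoopHolonomy

/-
Fix a path `p` ending at `x` and prolong it by straight segments in a chart around `x`. In the
trivialization of `E` over this family of paths the question is how much the prolongation of `p`
along a curve `r` through `x` differs, under `H`, from its prolongation along a straight segment.
The answer is: not to first order. To see this, let the coordinates of `r` run with independent
parameters. This gives a smooth family of loops depending on `n` parameters, and if only one of
these differs from `0`, then both prolongations run inside one coordinate line and differ by a thin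
loop. So `H` is constant on the axes, and its differential at the origin vanishes.

Consequently `Γ_a` and `V_a` are the two factors of the tangent space in this trivialization, `ω`
is the second coordinate translated to the identity, and the formulas follow by the chain rule.
-/

namespace LoopHolonomy

section Thin

variable {X M : Type*}

theorem pcomp_map (p : X → M) (f g : unitInterval → X) : (p ∘ f) ⊙ (p ∘ g) = p ∘ (f ⊙ g) := by
  funext t
  simp only [pcomp, Function.comp_apply]
  split_ifs <;> rfl

theorem pinv_map (p : X → M) (f : unitInterval → X) : pinv (p ∘ f) = p ∘ pinv f := rfl

theorem pcomp_const (x : M) :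
    ((fun _ => x : unitInterval → M) ⊙ fun _ => x) = fun _ => x :=
  pcomp_map (fun _ : Unit => x) (fun _ => ()) fun _ => ()

variable [TopologicalSpace M]

theorem continuous_pcomp {α β : unitInterval → M} (hα : Continuous α) (hβ : Continuous β)
    (h : β 1 = α 0) : Continuous (α ⊙ β) := by
  let P : Path (β 0) (α 0) := ⟨⟨β, hβ⟩, rfl, h⟩
  let Q : Path (α 0) (α 1) := ⟨⟨α, hα⟩, rfl, rfl⟩
  exact (P.trans Q).continuous

theorem isThin_pinv_pcomp_of_homotopic {R : Set M} {x y : R} {P Q : Path x y}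
    (hPQ : P.Homotopic Q) {α β : unitInterval → M} (hα : (fun t => (P t : M)) = α)
    (hβ : (fun t => (Q t : M)) = β) (hR : R ⊆ range α ∪ range β) : IsThin (pinv α ⊙ β) := by
  subst hα hβ
  refine isThin_of_homotopic (Q.trans P.symm) ?_
    (fun t => (congrFun (coe_trans Q P.symm) t).symm) ?_
  · rw [← Path.Homotopic.Quotient.eq] at hPQ ⊢
    simp [← hPQ]
  · rwa [pcomp_range (by simp), pinv_range]

theorem isThin_pinv_pcomp_cancel {p s : unitInterval → M} (hp : Continuous p) (hs : Continuous s)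
    (h : s 1 = p 1) : IsThin (pinv p ⊙ ((s ⊙ pinv s) ⊙ p)) := by
  let R := range p ∪ range s
  let P := liftPath (R := R) p hp fun t => Or.inl ⟨t, rfl⟩
  let S := (liftPath (R := R) s hs fun t => Or.inr ⟨t, rfl⟩).cast
    (y' := ⟨p 1, Or.inl ⟨1, rfl⟩⟩) rfl (Subtype.ext h.symm)
  refine isThin_pinv_pcomp_of_homotopic (P := P) (Q := P.trans (S.symm.trans S)) ?_ rfl ?_ ?_
  · rw [← Path.Homotopic.Quotient.eq]
    simp
  · rw [coe_trans, coe_trans]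
    rfl
  · rw [pcomp_range (by simp [h]), pcomp_range (by simp), pinv_range]
    intro x hx
    simp only [R, mem_union] at hx ⊢
    tauto

theorem isThin_transport {p α β : unitInterval → M} (hp : Continuous p) (hα : Continuous α)
    (hβ : Continuous β) (hβp : β 1 = p 1) (hαβ : α 0 = β 0) :
    IsThin (pinv (pinv β ⊙ p) ⊙ (pinv α ⊙ ((α ⊙ pinv β) ⊙ p))) := by
  let R := range p ∪ range α ∪ range β
  let P := liftPath (R := R) p hp fun t => Or.inl (Or.inl ⟨t, rfl⟩)
  let A := liftPath (R := R) α hα fun t => Or.inl (Or.inr ⟨t, rfl⟩)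
  let B := (liftPath (R := R) β hβ fun t => Or.inr ⟨t, rfl⟩).cast
    (x' := ⟨α 0, Or.inl (Or.inr ⟨0, rfl⟩)⟩) (y' := ⟨p 1, Or.inl (Or.inl ⟨1, rfl⟩)⟩)
    (Subtype.ext hαβ) (Subtype.ext hβp.symm)
  refine isThin_pinv_pcomp_of_homotopic (P := P.trans B.symm)
    (Q := (P.trans (B.symm.trans A)).trans A.symm) ?_ ?_ ?_ ?_
  · rw [← Path.Homotopic.Quotient.eq]
    simp [Path.Homotopic.Quotient.trans_assoc]
  · rw [coe_trans]
    rfl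
  · rw [coe_trans, coe_trans, coe_trans]
    rfl
  · rw [pcomp_range (by simp [hβp]), pcomp_range (by simp),
      pcomp_range (by simp [hβp]), pcomp_range (by simp [hαβ]), pinv_range, pinv_range]
    intro x hx
    simp only [R, mem_union] at hx ⊢
    tauto

theorem isThin_map_pcomp {p : ℝ → M} {f f' : unitInterval → ℝ}
    (hp : ContinuousOn p (range f ∪ range f')) (hf : Continuous f) (hf' : Continuous f')
    (h0 : f 0 = f' 0) (h1 : f 1 = f' 1) {χ : unitInterval → M} (hχ : Continuous χ)
    (hχ1 : χ 1 = p (f 0)) : IsThin (pinv ((p ∘ f) ⊙ χ) ⊙ ((p ∘ f') ⊙ χ)) := by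
  let C := range f ∪ range f'
  have hC : Convex ℝ C := Real.convex_iff_isPreconnected.2
    ((isPreconnected_range hf).union (f 0) ⟨0, rfl⟩ ⟨0, h0.symm⟩ (isPreconnected_range hf'))
  have : ContractibleSpace C := hC.contractibleSpace ⟨f 0, Or.inl ⟨0, rfl⟩⟩
  let A := liftPath (R := C) f hf fun t => Or.inl ⟨t, rfl⟩
  let A' := (liftPath (R := C) f' hf' fun t => Or.inr ⟨t, rfl⟩).cast
    (x' := ⟨f 0, Or.inl ⟨0, rfl⟩⟩) (y' := ⟨f 1, Or.inl ⟨1, rfl⟩⟩)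
    (Subtype.ext h0) (Subtype.ext h1)
  let R := p '' C ∪ range χ
  let m : C → R := fun u => ⟨p u, Or.inl ⟨u, u.2, rfl⟩⟩
  have hm : Continuous m := hp.domRestrict.subtype_mk _
  let X := (liftPath (R := R) χ hχ fun t => Or.inr ⟨t, rfl⟩).cast
    (y' := m ⟨f 0, Or.inl ⟨0, rfl⟩⟩) rfl (Subtype.ext hχ1.symm)
  refine isThin_pinv_pcomp_of_homotopic (P := X.trans (A.map hm)) (Q := X.trans (A'.map hm))
    ((Path.Homotopic.refl X).hcomp ((SimplyConnectedSpace.paths_homotopic A A').map ⟨m, hm⟩))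
    (coe_trans _ _) (coe_trans _ _) ?_
  rw [pcomp_range hχ1, pcomp_range (hχ1.trans (congrArg p h0)), range_comp, range_comp]
  simp only [R, C, image_union]
  intro x hx
  simp only [mem_union] at hx ⊢
  tauto

theorem isThin_arc_contr {r : unitInterval → M} (hr : Continuous r) (i j : unitInterval)
    {χ : unitInterval → M} (hχ : Continuous χ) (h : χ 1 = r j) :
    IsThin (pinv ((fun t : unitInterval => IccExtend zero_le_one r (j + t * (i - j))) ⊙ χ) ⊙
      ((contr r i ⊙ pinv (contr r j)) ⊙ χ)) := by
  have contr_eq (k : unitInterval) :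
      contr r k = IccExtend zero_le_one r ∘ fun t : unitInterval => (k : ℝ) * t := by
    funext t
    exact (IccExtend_val zero_le_one r (k * t)).symm
  have hmul (k : unitInterval) : Continuous fun t : unitInterval => (k : ℝ) * t := by fun_prop
  rw [contr_eq, contr_eq, pinv_map, pcomp_map]
  exact isThin_map_pcomp (f := fun t : unitInterval => (j : ℝ) + t * (i - j))
    hr.Icc_extend'.continuousOn (by fun_prop)
    (continuous_pcomp (hmul i) ((hmul j).comp unitInterval.continuous_symm) (by simp))
    (by simp) (by simp) hχ (by simp [h])

end Thin

section StraightPath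

variable {n : ℕ} {M : Type*} [TopologicalSpace M] {φ : OpenPartialHomeomorph M (Euc n)}

theorem straightPath_zero {x : M} (hx : x ∈ φ.source) (y : Euc n) :
    straightPath φ y (φ x) 0 = x := by
  simp [straightPath, φ.left_inv hx]

theorem straightPath_one (y x : Euc n) : straightPath φ y x 1 = φ.symm y := by
  simp [straightPath]

theorem straightPath_self (x : Euc n) : straightPath φ x x = fun _ => φ.symm x := by
  funext t
  simp [straightPath]

end StraightPath

section Families

variable {n : ℕ} {M : Type*} [TopologicalSpace M] [ChartedSpace (Euc n) M]
  {E : Type*} [NormedAddCommGroup E] [NormedSpace ℝ E] {H' : Type*} [TopologicalSpace H']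
  {J : ModelWithCorners ℝ E H'} {N : Type*} [TopologicalSpace N] [ChartedSpace H' N]

theorem SmoothFamilyOn.contMDiffOn_one {U : Set N} {ψ : N → unitInterval → M}
    (h : SmoothFamilyOn n J U ψ) : ContMDiffOn J (𝓡 n) ∞ (fun u => ψ u 1) U := by
  obtain ⟨-, S, hS⟩ := h
  refine ((hS 1 1 zero_le_one le_rfl le_rfl (by simp)).comp (f := fun u : N => (u, (1 : ℝ)))
    (contMDiff_id.prodMk contMDiff_const).contMDiffOn (fun u hu => ⟨hu, by simp⟩)).congr
    fun u _ => ?_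
  simp

theorem smoothFamilyOn_of_contMDiffOn {U : Set N} {f : N × ℝ → M}
    (hf : ContMDiffOn (J.prod 𝓘(ℝ, ℝ)) (𝓡 n) ∞ f (U ×ˢ Icc (0 : ℝ) 1)) :
    SmoothFamilyOn n J U fun u t => f (u, t) := by
  refine ⟨?_, ∅, fun a c h0 _ h1 _ => ?_⟩
  · exact hf.continuousOn.comp (f := fun z : N × unitInterval => (z.1, (z.2 : ℝ)))
      (by fun_prop) fun z hz => ⟨hz.1, z.2.2⟩
  · refine (hf.mono (prod_mono Subset.rfl (Icc_subset_Icc h0 h1))).congr fun z hz => ?_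
    rw [IccExtend_of_mem _ _ ⟨h0.trans hz.2.1, hz.2.2.trans h1⟩]

theorem smoothFamilyOn_radial {V : Set E} (hV : StarConvex ℝ 0 V) {f : E → M}
    (hf : ContMDiffOn 𝓘(ℝ, E) (𝓡 n) ∞ f V) :
    SmoothFamilyOn n 𝓘(ℝ, E) V fun v t => f ((t : ℝ) • v) := by
  have hsmul : ContMDiff (𝓘(ℝ, E).prod 𝓘(ℝ, ℝ)) 𝓘(ℝ, E) ∞ fun z : E × ℝ => z.2 • z.1 :=
    contMDiff_snd.smul contMDiff_fst
  exact smoothFamilyOn_of_contMDiffOn (hf.comp hsmul.contMDiffOn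
    fun z hz => hV.smul_mem hz.1 hz.2.1 hz.2.2)

theorem smoothFamilyOn_straightPath {φ : OpenPartialHomeomorph M (Euc n)}
    (hφ : φ ∈ IsManifold.maximalAtlas (𝓡 n) ∞ M) {x : Euc n}
    {C : Set (Euc n)} (hC : StarConvex ℝ x C) (hCφ : C ⊆ φ.target) {U : Set N} {y : N → Euc n}
    (hy : ContMDiffOn J (𝓡 n) ∞ y U) (hyC : MapsTo y U C) :
    SmoothFamilyOn n J U fun u => straightPath φ (y u) x := by
  have hV : StarConvex ℝ 0 ((fun v => x + v) ⁻¹' C) := by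
    refine StarConvex.preimage_add_right ?_
    rwa [add_zero]
  have hadd : ContMDiff (𝓡 n) (𝓡 n) ∞ fun v : Euc n => x + v :=
    contMDiff_const.add contMDiff_id
  have hsymm := contMDiffOn_symm_of_mem_maximalAtlas hφ
  exact (smoothFamilyOn_radial hV (hsymm.comp hadd.contMDiffOn fun v hv => hCφ hv)).comp
    (hy.sub contMDiffOn_const) fun u hu => by simpa using hyC hu

end Families

section Values

variable {n d : ℕ} {M : Type*} [TopologicalSpace M] [ChartedSpace (Euc n) M] {b : M}
  {G : Type*} [Group G] [TopologicalSpace G] [ChartedSpace (Euc d) G]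

/-- The prolongation of a path of `PM` by a path that starts at its end point. -/
noncomputable def BasedPath.prolong (p : BasedPath n b) (s : unitInterval → M)
    (hs : PiecewiseSmooth n s) (h : p 1 = s 0) : BasedPath n b where
  toFun := s ⊙ p
  smooth := hs.pcomp p.smooth h
  source := by simpa using p.source

namespace HolonomyMap

variable (H : HolonomyMap n d b G)

theorem val_eq_of_isThin {α β : BasedPath n b} (hα : α 1 = b) (hβ : β 1 = b)
    (h : IsThin (pinv β ⊙ α)) : H.val α = H.val β := by
  have hβ' : PiecewiseSmooth n (pinv β) := β.smooth.pinv
  have h0 : pinv β 0 = b := by simp [hβ]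
  have h1 : pinv β 1 = b := by simp [β.source]
  have hαβ := H.val_pcomp hβ' h0 h1 α.smooth α.source hα
  have hββ := H.val_pcomp hβ' h0 h1 β.smooth β.source hβ
  rw [H.val_thin h] at hαβ
  rw [H.val_self] at hββ
  exact mul_right_cancel (hαβ.symm.trans hββ)

theorem val_congr_left {p q r : BasedPath n b} (hq : q 1 = p 1) (hr : r 1 = p 1)
    (h : IsThin (pinv p ⊙ q)) : H.val (pinv q ⊙ r) = H.val (pinv p ⊙ r) := by
  rw [← H.val_trans hq hr, H.val_thin h, mul_one]

theorem val_transport {p α β : BasedPath n b} (hβ : β 1 = p 1) :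
    H.val (pinv α ⊙ ((α ⊙ pinv β) ⊙ p)) = H.val (pinv β ⊙ p) := by
  have hαβ : PiecewiseSmooth n (α ⊙ pinv β) :=
    α.smooth.pcomp β.smooth.pinv (by simp [α.source, β.source])
  have hp : PiecewiseSmooth n ((α ⊙ pinv β) ⊙ p) := hαβ.pcomp p.smooth (by simp [hβ])
  exact H.val_eq_of_isThin
    (α := ⟨_, α.smooth.pinv.pcomp hp (by simp), by simp [p.source]⟩)
    (β := ⟨_, β.smooth.pinv.pcomp p.smooth (by simp [hβ]), by simp [p.source]⟩)
    (by simp [α.source]) (by simp [β.source])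
    (isThin_transport p.smooth.1 α.smooth.1 β.smooth.1 hβ (α.source.trans β.source.symm))

variable {E : Type*} [NormedAddCommGroup E] [NormedSpace ℝ E] [FiniteDimensional ℝ E]

theorem contMDiffOn_val_space {U : Set E} (hU : IsOpen U) {w : E → unitInterval → M}
    (hw : SmoothFamilyOn n 𝓘(ℝ, E) U w) (h0 : ∀ u ∈ U, w u 0 = b) (h1 : ∀ u ∈ U, w u 1 = b) :
    ContMDiffOn 𝓘(ℝ, E) (𝓡 d) ∞ (fun u => H.val (w u)) U := by
  classical
  let e : E ≃L[ℝ] Euc (Module.finrank ℝ E) := toEuclidean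
  let V := e.symm ⁻¹' U
  have hfam : SmoothFamilyOn n (𝓡 (Module.finrank ℝ E)) V fun v => w (e.symm v) :=
    hw.comp e.symm.contDiff.contMDiff.contMDiffOn fun v hv => hv
  let Ω : Euc (Module.finrank ℝ E) → BasedLoop n b := fun v =>
    if hv : v ∈ V then ⟨⟨w (e.symm v), hfam.piecewiseSmooth hv, h0 _ hv⟩, h1 _ hv⟩
    else ⟨constPath n b, rfl⟩
  have hΩ : ∀ v ∈ V, (Ω v : unitInterval → M) = w (e.symm v) := fun v hv => by
    simp only [Ω, dif_pos hv]
  have hval : ContMDiffOn (𝓡 (Module.finrank ℝ E)) (𝓡 d) ∞ (fun v => H.val (w (e.symm v))) V := by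
    refine (H.smooth _ _ (hU.preimage e.symm.continuous) Ω (hfam.congr hΩ)).congr
      fun v (hv : v ∈ V) => ?_
    rw [H.val_eq (hfam.piecewiseSmooth hv) (h0 _ hv) (h1 _ hv)]
    simp only [Ω, dif_pos hv]
  refine (hval.comp (f := e) e.contDiff.contMDiff.contMDiffOn fun u hu => ?_).congr
    fun _ _ => ?_
  · simpa [V] using hu
  · simp

end HolonomyMap

end Values

section Axes

variable {E : Type*} [NormedAddCommGroup E] [NormedSpace ℝ E]
  {F : Type*} [NormedAddCommGroup F] [NormedSpace ℝ F] {H' : Type*} [TopologicalSpace H']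
  {J : ModelWithCorners ℝ F H'} {N : Type*} [TopologicalSpace N] [ChartedSpace H' N]

theorem hasMFDerivAt_zero_of_eventually_const_axes {ι : Type*} (B : Module.Basis ι ℝ E)
    {f : E → N} (hf : MDifferentiableAt 𝓘(ℝ, E) J f 0) {c : N}
    (hc : ∀ i, ∀ᶠ u : ℝ in 𝓝 0, f (u • B i) = c) :
    HasMFDerivAt 𝓘(ℝ, E) J f 0 (0 : E →L[ℝ] F) := by
  obtain ⟨D, hD⟩ : ∃ D : E →L[ℝ] F, HasMFDerivAt 𝓘(ℝ, E) J f 0 D := ⟨_, hf.hasMFDerivAt⟩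
  have hD0 : D = 0 := ContinuousLinearMap.coe_injective <| B.ext fun i => by
    let L : ℝ →L[ℝ] E := ContinuousLinearMap.toSpanSingleton ℝ (B i)
    have hL : HasMFDerivAt 𝓘(ℝ, ℝ) 𝓘(ℝ, E) L 0 L := L.hasFDerivAt.hasMFDerivAt
    have hDL : HasMFDerivAt 𝓘(ℝ, ℝ) J (f ∘ L) 0 (D.comp L) :=
      HasMFDerivAt.comp (0 : ℝ) (by rwa [map_zero]) hL
    have hDL0 : D.comp L = 0 := hasMFDerivAt_unique hDL
      ((hasMFDerivAt_const c (0 : ℝ)).congr_of_eventuallyEq (hc i))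
    simpa [L] using DFunLike.congr_fun hDL0 1
  rwa [hD0] at hD

end Axes

section MultiCurve

variable {n : ℕ}

/-- The curve `ρ` with an independent parameter for each of its coordinates: it is `ρ` along the
diagonal, and on each coordinate axis it runs in a coordinate line through `ρ 0`. -/
noncomputable def multiCurve (ρ : ℝ → Euc n) (s : Euc n) : Euc n :=
  WithLp.toLp 2 fun μ => ρ (s μ) μ

theorem multiCurve_diag (ρ : ℝ → Euc n) (t : ℝ) :
    multiCurve ρ (t • WithLp.toLp 2 fun _ => 1) = ρ t := by
  ext μ
  simp [multiCurve]

theorem multiCurve_axis (ρ : ℝ → Euc n) (μ : Fin n) (t : ℝ) :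
    multiCurve ρ (t • EuclideanSpace.single μ 1) =
      ρ 0 + (ρ t μ - ρ 0 μ) • EuclideanSpace.single μ 1 := by
  ext ν
  rcases eq_or_ne ν μ with rfl | hν <;> simp [multiCurve, *]

theorem multiCurve_zero (ρ : ℝ → Euc n) : multiCurve ρ 0 = ρ 0 := by
  simpa using multiCurve_diag ρ 0

theorem exists_ball_contDiffOn_multiCurve {ρ : ℝ → Euc n}
    (hρ : ∀ᶠ t in 𝓝 (0 : ℝ), ContDiffAt ℝ ∞ ρ t) {W : Set (Euc n)} (hW : W ∈ 𝓝 (ρ 0)) :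
    ∃ ε > 0, ContDiffOn ℝ ∞ (multiCurve ρ) (Metric.ball 0 ε) ∧
      MapsTo (multiCurve ρ) (Metric.ball 0 ε) W := by
  have hsmooth : ∀ᶠ s : Euc n in 𝓝 0, ContDiffAt ℝ ∞ (multiCurve ρ) s := by
    have hcoord : ∀ᶠ s : Euc n in 𝓝 0, ∀ μ, ContDiffAt ℝ ∞ ρ (s μ) := eventually_all.2 fun μ =>
      (by fun_prop : Continuous fun s : Euc n => s μ).tendsto' 0 0 rfl |>.eventually hρ
    filter_upwards [hcoord] with s hs
    refine contDiffAt_euclidean.2 fun μ => ?_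
    have hμ := contDiffAt_euclidean.1 (hs μ) μ
    exact hμ.comp s (by fun_prop : ContDiff ℝ ∞ fun s : Euc n => s μ).contDiffAt
  have hmaps : ∀ᶠ s : Euc n in 𝓝 0, multiCurve ρ s ∈ W :=
    hsmooth.self_of_nhds.continuousAt.eventually (by rwa [multiCurve_zero])
  obtain ⟨ε, hε, h⟩ := Metric.eventually_nhds_iff_ball.1 (hsmooth.and hmaps)
  exact ⟨ε, hε, fun s hs => (h s hs).1.contDiffWithinAt, fun s hs => (h s hs).2⟩

/-- The path in `M` that the curve `ρ` with independent coordinate parameters, read in the chart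
`φ`, describes along the segment from `0` to `s`. -/
noncomputable def multiArc {M : Type*} [TopologicalSpace M] (φ : OpenPartialHomeomorph M (Euc n))
    (ρ : ℝ → Euc n) (s : Euc n) : unitInterval → M :=
  fun t => φ.symm (multiCurve ρ ((t : ℝ) • s))

theorem multiArc_diag {M : Type*} [TopologicalSpace M]
    {φ : OpenPartialHomeomorph M (Euc n)} {R : ℝ → M} {j i : ℝ}
    (h : ∀ t : unitInterval, R (j + t * (i - j)) ∈ φ.source) :
    multiArc φ (fun σ => φ (R (j + σ))) ((i - j) • WithLp.toLp 2 fun _ => 1) =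
      fun t : unitInterval => R (j + t * (i - j)) := by
  funext t
  simp only [multiArc, smul_smul, multiCurve_diag, φ.left_inv (h t)]

end MultiCurve

section CoordinateLines

variable {n : ℕ} {M : Type*} [TopologicalSpace M] {φ : OpenPartialHomeomorph M (Euc n)}
  {p : unitInterval → M} {C : Set (Euc n)}

theorem isThin_straightPath_of_line (hp : Continuous p) (hpφ : p 1 ∈ φ.source)
    (hC : StarConvex ℝ (φ (p 1)) C) (hCφ : C ⊆ φ.target) {v : Euc n}
    {f : unitInterval → ℝ} (hf : Continuous f) (hf0 : f 0 = 0)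
    (hfC : ∀ t, φ (p 1) + f t • v ∈ C) :
    IsThin (pinv ((fun t => φ.symm (φ (p 1) + f t • v)) ⊙ p) ⊙
      (straightPath φ (φ (p 1) + f 1 • v) (φ (p 1)) ⊙ p)) := by
  let ℓ : ℝ → M := fun τ => φ.symm (φ (p 1) + τ • v)
  let f' : unitInterval → ℝ := fun t => t * f 1
  have hstraight : straightPath φ (φ (p 1) + f 1 • v) (φ (p 1)) = ℓ ∘ f' := by
    funext t
    simp [straightPath, ℓ, f', smul_smul]
  have hmaps : MapsTo (fun τ : ℝ => φ (p 1) + τ • v) (range f ∪ range f') φ.target := by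
    rintro _ (⟨t, rfl⟩ | ⟨t, rfl⟩)
    · exact hCφ (hfC t)
    · simpa [f', smul_smul] using hCφ (hC.add_smul_sub_mem (hfC 1) t.2.1 t.2.2)
  rw [hstraight]
  exact isThin_map_pcomp (p := ℓ) (f := f)
    (φ.continuousOn_symm.comp (by fun_prop) hmaps) hf (by fun_prop) (by simp [f', hf0])
    (by simp [f']) hp (by simp [ℓ, hf0, φ.left_inv hpφ])

theorem isThin_multiArc_axis (hp : Continuous p) (hpφ : p 1 ∈ φ.source)
    (hC : StarConvex ℝ (φ (p 1)) C) (hCφ : C ⊆ φ.target) {ρ : ℝ → Euc n} (hρ0 : ρ 0 = φ (p 1))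
    {V : Set (Euc n)} (hV : StarConvex ℝ 0 V) (hρV : ContinuousOn (multiCurve ρ) V)
    (hρC : MapsTo (multiCurve ρ) V C) {μ : Fin n} {u : ℝ}
    (hu : u • EuclideanSpace.single μ 1 ∈ V) :
    IsThin (pinv (multiArc φ ρ (u • EuclideanSpace.single μ 1) ⊙ p) ⊙
      (straightPath φ (multiCurve ρ (u • EuclideanSpace.single μ 1)) (φ (p 1)) ⊙ p)) := by
  have hV' (t : unitInterval) : ((t : ℝ) * u) • EuclideanSpace.single μ (1 : ℝ) ∈ V := by
    rw [← smul_smul]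
    exact hV.smul_mem hu t.2.1 t.2.2
  have haxis (t : ℝ) : multiCurve ρ (t • EuclideanSpace.single μ 1) =
      φ (p 1) + (ρ t μ - φ (p 1) μ) • EuclideanSpace.single μ 1 := by
    rw [multiCurve_axis, hρ0]
  have hcont : Continuous fun t : unitInterval => ρ (t * u) μ - φ (p 1) μ := by
    have hcoord : Continuous fun t : unitInterval =>
        multiCurve ρ (((t : ℝ) * u) • EuclideanSpace.single μ 1) μ - φ (p 1) μ :=
      ((EuclideanSpace.proj μ).continuous.comp
        (hρV.comp_continuous (by fun_prop) hV')).sub continuous_const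
    simpa [multiCurve] using hcoord
  have hthin := isThin_straightPath_of_line hp hpφ hC hCφ hcont (by simp [hρ0])
    fun t => haxis (t * u) ▸ hρC (hV' t)
  have harc : multiArc φ ρ (u • EuclideanSpace.single μ 1) = fun t : unitInterval =>
      φ.symm (φ (p 1) + (ρ (t * u) μ - φ (p 1) μ) • EuclideanSpace.single μ 1) := by
    funext t
    simp only [multiArc, smul_smul, haxis]
  simpa only [harc, haxis, Icc.coe_one, one_mul] using hthin

end CoordinateLines

section FirstOrder

variable {n d : ℕ} {M : Type*} [TopologicalSpace M] [ChartedSpace (Euc n) M] {b : M}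
  {G : Type*} [Group G] [TopologicalSpace G] [ChartedSpace (Euc d) G]
  {φ : OpenPartialHomeomorph M (Euc n)}

namespace HolonomyMap

variable (H : HolonomyMap n d b G)

theorem contMDiffOn_val_multiArc (p : BasedPath n b)
    (hφ : φ ∈ IsManifold.maximalAtlas (𝓡 n) ∞ M) (hpφ : p 1 ∈ φ.source) {C : Set (Euc n)}
    (hC : StarConvex ℝ (φ (p 1)) C) (hCφ : C ⊆ φ.target) {ρ : ℝ → Euc n} (hρ0 : ρ 0 = φ (p 1))
    {V : Set (Euc n)} (hVo : IsOpen V) (hV : StarConvex ℝ 0 V)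
    (hρV : ContDiffOn ℝ ∞ (multiCurve ρ) V) (hρC : MapsTo (multiCurve ρ) V C) :
    ContMDiffOn (𝓡 n) (𝓡 d) ∞ (fun s => H.val (pinv (multiArc φ ρ s ⊙ p) ⊙
      (straightPath φ (multiCurve ρ s) (φ (p 1)) ⊙ p))) V := by
  have hp : SmoothFamilyOn n (𝓡 n) V fun _ => (p : unitInterval → M) := .const p.smooth V
  have hsymm := contMDiffOn_symm_of_mem_maximalAtlas hφ
  have harc : SmoothFamilyOn n (𝓡 n) V (multiArc φ ρ) :=
    smoothFamilyOn_radial hV (hsymm.comp hρV.contMDiffOn fun s hs => hCφ (hρC hs))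
  have hstraight := smoothFamilyOn_straightPath hφ hC hCφ hρV.contMDiffOn hρC
  refine H.contMDiffOn_val_space hVo ((harc.pcomp hp fun s _ => ?_).pinv.pcomp
    (hstraight.pcomp hp fun s _ => ?_) fun s _ => ?_) (fun s _ => ?_) fun s _ => ?_
  · simp [multiArc, multiCurve_zero, hρ0, φ.left_inv hpφ]
  · exact (straightPath_zero hpφ _).symm
  · simp [multiArc, straightPath_one]
  · simp [p.source]
  · simp [p.source]

theorem hasMFDerivAt_val_multiArc (p : BasedPath n b)
    (hφ : φ ∈ IsManifold.maximalAtlas (𝓡 n) ∞ M) (hpφ : p 1 ∈ φ.source) {ρ : ℝ → Euc n}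
    (hρ : ∀ᶠ t in 𝓝 (0 : ℝ), ContDiffAt ℝ ∞ ρ t) (hρ0 : ρ 0 = φ (p 1)) :
    HasMFDerivAt (𝓡 n) (𝓡 d) (fun s => H.val (pinv (multiArc φ ρ s ⊙ p) ⊙
      (straightPath φ (multiCurve ρ s) (φ (p 1)) ⊙ p))) 0 (0 : Euc n →L[ℝ] Euc d) := by
  obtain ⟨δ, hδ, hδφ⟩ := Metric.isOpen_iff.1 φ.open_target _ (φ.map_source hpφ)
  have hC := (convex_ball (φ (p 1)) δ).starConvex (Metric.mem_ball_self hδ)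
  obtain ⟨ε, hε, hρV, hρC⟩ := exists_ball_contDiffOn_multiCurve hρ
    (W := Metric.ball (φ (p 1)) δ) (by rw [hρ0]; exact Metric.ball_mem_nhds _ hδ)
  have hV := (convex_ball (0 : Euc n) ε).starConvex (Metric.mem_ball_self hε)
  have hsmooth := H.contMDiffOn_val_multiArc p hφ hpφ hC hδφ hρ0 Metric.isOpen_ball hV hρV hρC
  refine hasMFDerivAt_zero_of_eventually_const_axes (EuclideanSpace.basisFun (Fin n) ℝ).toBasis
    ((hsmooth.contMDiffAt (Metric.ball_mem_nhds 0 hε)).mdifferentiableAt (by simp)) (c := 1)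
    fun μ => ?_
  filter_upwards [Metric.ball_mem_nhds 0 hε] with u hu
  have huV : u • EuclideanSpace.single μ (1 : ℝ) ∈ Metric.ball 0 ε := by
    simpa [norm_smul] using hu
  simpa using H.val_thin (isThin_multiArc_axis p.smooth.1 hpφ hC hδφ hρ0 hV hρV.continuousOn
    hρC huV)

end HolonomyMap

end FirstOrder

section Transport

variable {n d : ℕ} {M : Type*}

/-- The path `K(r,i) ∘ K(r,j)⁻¹` from `r(j)` back to `r(0)` and on to `r(i)` along `r`. -/
noncomputable def pathBetween (r : unitInterval → M) (j i : ℝ) : unitInterval → M :=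
  contr r (projIcc 0 1 zero_le_one i) ⊙ pinv (contr r (projIcc 0 1 zero_le_one j))

theorem pathBetween_zero (r : unitInterval → M) (j i : ℝ) :
    pathBetween r j i 0 = IccExtend zero_le_one r j := by
  simp [pathBetween, contr, IccExtend]

theorem pathBetween_one (r : unitInterval → M) (j i : ℝ) :
    pathBetween r j i 1 = IccExtend zero_le_one r i := by
  simp [pathBetween, contr, IccExtend]

variable [TopologicalSpace M] [ChartedSpace (Euc n) M] {r : unitInterval → M}

theorem BasedPath.contr_one {b : M} (r : BasedPath n b) (i : ℝ) :
    r.contr (projIcc 0 1 zero_le_one i) 1 = IccExtend zero_le_one r i := by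
  simp [BasedPath.contr, LoopHolonomy.contr, IccExtend]

theorem PiecewiseSmooth.pathBetween (hr : PiecewiseSmooth n r) (j i : ℝ) :
    PiecewiseSmooth n (pathBetween r j i) :=
  (hr.contr _).pcomp (hr.contr _).pinv (by simp [LoopHolonomy.contr])

theorem piecewiseSmooth_straightPath {φ : OpenPartialHomeomorph M (Euc n)}
    (hφ : φ ∈ IsManifold.maximalAtlas (𝓡 n) ∞ M) {x y : Euc n} {C : Set (Euc n)}
    (hC : StarConvex ℝ x C) (hCφ : C ⊆ φ.target) (hy : y ∈ C) :
    PiecewiseSmooth n (straightPath φ y x) :=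
  (smoothFamilyOn_straightPath hφ hC hCφ contMDiffOn_id (mapsTo_id C)).piecewiseSmooth hy

theorem eventually_arc_mem {R : ℝ → M} {j : ℝ} {W : Set M} (hW : W ∈ 𝓝 (R j))
    (hR : ContinuousAt R j) :
    ∀ᶠ i in 𝓝 j, ∀ t : unitInterval, R (j + t * (i - j)) ∈ W := by
  obtain ⟨δ, hδ, h⟩ := Metric.eventually_nhds_iff_ball.1 (hR.eventually hW)
  have hball := (convex_ball j δ).starConvex (Metric.mem_ball_self hδ)
  filter_upwards [Metric.ball_mem_nhds j hδ] with i hi t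
  exact h _ (hball.add_smul_sub_mem hi t.2.1 t.2.2)

theorem eventually_piecewiseSmooth_arc {R : ℝ → M} {j : ℝ}
    (hR : ∀ᶠ t in 𝓝 j, ContMDiffAt 𝓘(ℝ, ℝ) (𝓡 n) ∞ R t) :
    ∀ᶠ i in 𝓝 j, PiecewiseSmooth n fun t : unitInterval => R (j + t * (i - j)) := by
  obtain ⟨δ, hδ, h⟩ := Metric.eventually_nhds_iff_ball.1 hR
  have hV := (convex_ball (0 : ℝ) δ).starConvex (Metric.mem_ball_self hδ)
  have hadd : ContMDiff 𝓘(ℝ, ℝ) 𝓘(ℝ, ℝ) ∞ fun σ : ℝ => j + σ := contMDiff_const.add contMDiff_id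
  have hfam := smoothFamilyOn_radial hV (f := fun σ => R (j + σ)) fun σ hσ =>
    (ContMDiffAt.comp σ (h _ (by simpa using hσ)) hadd.contMDiffAt).contMDiffWithinAt
  filter_upwards [Metric.ball_mem_nhds j hδ] with i hi
  exact hfam.piecewiseSmooth (u := i - j) (by simpa [Real.dist_eq] using hi)

theorem eventually_contDiffAt_chart_comp {φ : OpenPartialHomeomorph M (Euc n)}
    (hφ : φ ∈ IsManifold.maximalAtlas (𝓡 n) ∞ M) {R : ℝ → M} {j : ℝ}
    (hR : ∀ᶠ t in 𝓝 j, ContMDiffAt 𝓘(ℝ, ℝ) (𝓡 n) ∞ R t) (hj : R j ∈ φ.source) :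
    ∀ᶠ σ in 𝓝 (0 : ℝ), ContDiffAt ℝ ∞ (fun σ => φ (R (j + σ))) σ := by
  have hadd : Tendsto (fun σ : ℝ => j + σ) (𝓝 0) (𝓝 j) :=
    (by fun_prop : Continuous fun σ : ℝ => j + σ).tendsto' 0 j (add_zero j)
  have hsource := hR.self_of_nhds.continuousAt.eventually (φ.open_source.mem_nhds hj)
  filter_upwards [hadd.eventually hR, hadd.eventually hsource] with σ hσ hσφ
  have hφσ := (contMDiffOn_of_mem_maximalAtlas hφ).contMDiffAt (φ.open_source.mem_nhds hσφ)
  have hshift : ContMDiffAt 𝓘(ℝ, ℝ) 𝓘(ℝ, ℝ) ∞ (fun σ : ℝ => j + σ) σ :=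
    contMDiffAt_const.add contMDiffAt_id
  exact ((hφσ.comp (j + σ) hσ).comp σ hshift).contDiffAt

variable {b : M} {G : Type*} [Group G] [TopologicalSpace G] [ChartedSpace (Euc d) G]

namespace HolonomyMap

variable (H : HolonomyMap n d b G)

theorem val_pathBetween_eq_val_arc (hr : PiecewiseSmooth n r) {i j : ℝ} (hi : i ∈ Icc (0 : ℝ) 1)
    (hj : j ∈ Icc (0 : ℝ) 1) {p q : BasedPath n b} (hp : p 1 = IccExtend zero_le_one r j)
    (hq : q 1 = IccExtend zero_le_one r i) (harc : PiecewiseSmooth n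
      fun t : unitInterval => IccExtend zero_le_one r (j + t * (i - j))) :
    H.val (pinv (pathBetween r j i ⊙ p) ⊙ q) =
      H.val (pinv ((fun t : unitInterval =>
        IccExtend zero_le_one r (j + t * (i - j))) ⊙ p) ⊙ q) := by
  have hthin := isThin_arc_contr hr.1 (projIcc 0 1 zero_le_one i) (projIcc 0 1 zero_le_one j)
    p.smooth.1 hp
  simp only [projIcc_of_mem zero_le_one hi, projIcc_of_mem zero_le_one hj] at hthin
  refine H.val_congr_left (p := p.prolong _ harc (by simp [hp]))
    (q := p.prolong _ (hr.pathBetween j i) (hp.trans (pathBetween_zero r j i).symm))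
    (by simp [BasedPath.prolong, pathBetween_one]) (by simp [BasedPath.prolong, hq]) ?_
  simpa only [BasedPath.prolong, pathBetween, projIcc_of_mem zero_le_one hi,
    projIcc_of_mem zero_le_one hj] using hthin

theorem val_pathBetween_self (hr : PiecewiseSmooth n r) {j : ℝ} {p q : BasedPath n b}
    (hp : p 1 = IccExtend zero_le_one r j) (hq : q 1 = p 1) :
    H.val (pinv (pathBetween r j j ⊙ p) ⊙ q) = H.val (pinv p ⊙ q) :=
  H.val_congr_left
    (q := p.prolong _ (hr.pathBetween j j) (hp.trans (pathBetween_zero r j j).symm))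
    (by simp [BasedPath.prolong, pathBetween_one, hp]) hq
    (isThin_pinv_pcomp_cancel p.smooth.1 (hr.contr _).1 (by simp [contr, hp, IccExtend]))

theorem val_pathBetween_eventuallyEq_val_multiArc {φ : OpenPartialHomeomorph M (Euc n)}
    (p : BasedPath n b) (hφ : φ ∈ IsManifold.maximalAtlas (𝓡 n) ∞ M) (hpφ : p 1 ∈ φ.source)
    (hr : PiecewiseSmooth n r) {j : ℝ} (hj : j ∈ Ioo (0 : ℝ) 1)
    (hrj : ∀ᶠ t in 𝓝 j, ContMDiffAt 𝓘(ℝ, ℝ) (𝓡 n) ∞ (IccExtend zero_le_one r) t)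
    (hp : p 1 = IccExtend zero_le_one r j) :
    let ρ : ℝ → Euc n := fun σ => φ (IccExtend zero_le_one r (j + σ))
    let e : Euc n := WithLp.toLp 2 fun _ => 1
    (fun i => H.val (pinv (pathBetween r j i ⊙ p) ⊙
      (straightPath φ (φ (IccExtend zero_le_one r i)) (φ (p 1)) ⊙ p))) =ᶠ[𝓝 j]
    fun i => H.val (pinv (multiArc φ ρ ((i - j) • e) ⊙ p) ⊙
      (straightPath φ (multiCurve ρ ((i - j) • e)) (φ (p 1)) ⊙ p)) := by
  intro ρ e
  let R := IccExtend zero_le_one r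
  have hRφ : R j ∈ φ.source := by rwa [hp] at hpφ
  have hRc : ContinuousAt R j := hrj.self_of_nhds.continuousAt
  obtain ⟨δ, hδ, hδφ⟩ := Metric.isOpen_iff.1 φ.open_target _ (φ.map_source hpφ)
  have hball := (convex_ball (φ (p 1)) δ).starConvex (Metric.mem_ball_self hδ)
  have hchart : ∀ᶠ i in 𝓝 j, φ (R i) ∈ Metric.ball (φ (p 1)) δ :=
    ((φ.continuousAt hRφ).comp hRc).eventually (by rw [hp]; exact Metric.ball_mem_nhds _ hδ)
  filter_upwards [eventually_piecewiseSmooth_arc hrj, Icc_mem_nhds hj.1 hj.2, hchart,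
    eventually_arc_mem (φ.open_source.mem_nhds hRφ) hRc] with i harc hi hiδ hiφ
  have hstraight := piecewiseSmooth_straightPath hφ hball hδφ hiδ
  have hRi : φ.symm (φ (R i)) = R i := φ.left_inv (by simpa using hiφ 1)
  simp only [ρ, e]
  rw [multiArc_diag hiφ, multiCurve_diag, add_sub_cancel]
  exact H.val_pathBetween_eq_val_arc hr hi (Ioo_subset_Icc_self hj) hp
    (q := p.prolong _ hstraight (straightPath_zero hpφ _).symm)
    (by simpa [BasedPath.prolong, straightPath_one] using hRi) harc

theorem hasMFDerivAt_val_pathBetween {φ : OpenPartialHomeomorph M (Euc n)} (p : BasedPath n b)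
    (hφ : φ ∈ IsManifold.maximalAtlas (𝓡 n) ∞ M) (hpφ : p 1 ∈ φ.source)
    (hr : PiecewiseSmooth n r) {j : ℝ} (hj : j ∈ Ioo (0 : ℝ) 1)
    (hrj : ∀ᶠ t in 𝓝 j, ContMDiffAt 𝓘(ℝ, ℝ) (𝓡 n) ∞ (IccExtend zero_le_one r) t)
    (hp : p 1 = IccExtend zero_le_one r j) :
    HasMFDerivAt 𝓘(ℝ, ℝ) (𝓡 d) (fun i => H.val (pinv (pathBetween r j i ⊙ p) ⊙
      (straightPath φ (φ (IccExtend zero_le_one r i)) (φ (p 1)) ⊙ p))) j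
      (0 : ℝ →L[ℝ] Euc d) := by
  let ρ : ℝ → Euc n := fun σ => φ (IccExtend zero_le_one r (j + σ))
  let e : Euc n := WithLp.toLp 2 fun _ => 1
  have hmulti := H.hasMFDerivAt_val_multiArc p hφ hpφ (ρ := ρ)
    (eventually_contDiffAt_chart_comp hφ hrj (by rwa [hp] at hpφ)) (by simp [ρ, hp])
  have hdiag : HasMFDerivAt 𝓘(ℝ, ℝ) (𝓡 n) (fun i : ℝ => (i - j) • e) j
      (ContinuousLinearMap.toSpanSingleton ℝ e) :=
    (((hasFDerivAt_id j).sub_const j).smul_const e).hasMFDerivAt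
  have h0 : (j - j) • e = 0 := by simp
  have hcomp := HasMFDerivAt.comp j (h0.symm ▸ hmulti) hdiag
  exact (hcomp.congr_mfderiv (ContinuousLinearMap.zero_comp _)).congr_of_eventuallyEq
    (H.val_pathBetween_eventuallyEq_val_multiArc p hφ hpφ hr hj hrj hp)

end HolonomyMap

end Transport

section LieGroup

variable {𝕜 : Type*} [NontriviallyNormedField 𝕜]
  {E : Type*} [NormedAddCommGroup E] [NormedSpace 𝕜 E] {H₁ : Type*} [TopologicalSpace H₁]
  {I : ModelWithCorners 𝕜 E H₁} {G : Type*} [TopologicalSpace G] [ChartedSpace H₁ G] [Group G]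
  {F : Type*} [NormedAddCommGroup F] [NormedSpace 𝕜 F] {H₂ : Type*} [TopologicalSpace H₂]
  {J : ModelWithCorners 𝕜 F H₂} {N : Type*} [TopologicalSpace N] [ChartedSpace H₂ N]
  {q f : N → G} {x : N} {D : F →L[𝕜] E}

theorem hasMFDerivAt_mul_of_zero [ContMDiffMul I 1 G] (hq1 : q x = 1)
    (hq : HasMFDerivAt J I q x (0 : F →L[𝕜] E)) (hf : HasMFDerivAt J I f x D) :
    HasMFDerivAt J I (fun i => q i * f i) x D := by
  obtain ⟨L, hL⟩ : ∃ L : E × E →L[𝕜] E,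
      HasMFDerivAt (I.prod I) I (fun z : G × G => z.1 * z.2) (q x, f x) L :=
    ⟨_, ((contMDiff_mul I 1).mdifferentiableAt one_ne_zero).hasMFDerivAt⟩
  have hmul : HasMFDerivAt J I (fun i => q i * f i) x (L.comp ((0 : F →L[𝕜] E).prod D)) :=
    HasMFDerivAt.comp (f := fun i => (q i, f i)) x hL (hq.prodMk hf)
  have hleft : HasMFDerivAt I I (fun y : G => q x * y) (f x)
      (L.comp ((0 : E →L[𝕜] E).prod (ContinuousLinearMap.id 𝕜 E))) :=
    HasMFDerivAt.comp (f := fun y : G => (q x, y)) (f x) hL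
      ((hasMFDerivAt_const (q x) (f x)).prodMk (hasMFDerivAt_id (f x)))
  have hid : HasMFDerivAt I I (fun y : G => q x * y) (f x) (ContinuousLinearMap.id 𝕜 E) :=
    (hasMFDerivAt_id (I := I) (f x)).congr_of_eventuallyEq
      (Eventually.of_forall fun y => by simp [hq1])
  have hLid := hasMFDerivAt_unique hleft hid
  exact hmul.congr_mfderiv (ContinuousLinearMap.ext fun t => DFunLike.congr_fun hLid (D t))

theorem hasMFDerivAt_mul_iff_of_zero [LieGroup I 1 G] (hq1 : q x = 1)
    (hq : HasMFDerivAt J I q x (0 : F →L[𝕜] E)) :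
    HasMFDerivAt J I (fun i => q i * f i) x D ↔ HasMFDerivAt J I f x D := by
  refine ⟨fun h => ?_, hasMFDerivAt_mul_of_zero hq1 hq⟩
  have hinv : HasMFDerivAt J I (fun i => (q i)⁻¹) x (0 : F →L[𝕜] E) :=
    (HasMFDerivAt.comp x ((contMDiff_inv I 1).mdifferentiableAt one_ne_zero).hasMFDerivAt
      hq).congr_mfderiv (ContinuousLinearMap.comp_zero _)
  exact (hasMFDerivAt_mul_of_zero (by simp [hq1]) hinv h).congr_of_eventuallyEq
    (Eventually.of_forall fun i => (inv_mul_cancel_left (q i) (f i)).symm)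

theorem mfderiv_inv_mul_mfderiv_mul [ContMDiffMul I 1 G] {g y z : G} (h : g * y = z) (ξ : E) :
    mfderiv I I (fun w : G => g⁻¹ * w) z (mfderiv I I (fun w : G => g * w) y ξ) = ξ := by
  subst h
  have hmul (g w : G) : MDifferentiableAt I I (fun w : G => g * w) w :=
    (contMDiff_mul_left (I := I) (n := 1)).mdifferentiableAt one_ne_zero
  have hid := hasMFDerivAt_unique (HasMFDerivAt.comp y (hmul g⁻¹ (g * y)).hasMFDerivAt
    (hmul g y).hasMFDerivAt) ((hasMFDerivAt_id y).congr_of_eventuallyEq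
      (Eventually.of_forall fun w => inv_mul_cancel_left g w))
  exact DFunLike.congr_fun hid ξ

end LieGroup

section Manifold

variable {𝕜 : Type*} [NontriviallyNormedField 𝕜]
  {E : Type*} [NormedAddCommGroup E] [NormedSpace 𝕜 E] {H : Type*} [TopologicalSpace H]
  {I : ModelWithCorners 𝕜 E H}
  {X : Type*} [TopologicalSpace X] [ChartedSpace H X] [IsManifold I 1 X]
  {Y : Type*} [TopologicalSpace Y] [ChartedSpace H Y] [IsManifold I 1 Y]

theorem mdifferentiable_of_trans_chartAt_mem_atlas {e : OpenPartialHomeomorph X Y}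
    (he : ∀ y, e ≫ₕ chartAt H y ∈ atlas H X) : e.MDifferentiable I I := by
  refine ⟨fun x hx => ?_, fun y hy => ?_⟩
  · let c := chartAt H (e x)
    have hxc : x ∈ (e ≫ₕ c).source := by simp [c, hx]
    have hcomp := (mdifferentiableAt_atlas_symm (chart_mem_atlas H (e x))
      (mem_chart_target H (e x))).comp x (mdifferentiableAt_atlas (I := I) (he (e x)) hxc)
    refine (hcomp.congr_of_eventuallyEq ?_).mdifferentiableWithinAt
    filter_upwards [(e ≫ₕ c).open_source.mem_nhds hxc] with x' hx'
    exact (c.left_inv (e.trans_source c ▸ hx').2).symm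
  · let c := chartAt H y
    have hyc : c y ∈ (e ≫ₕ c).target := by simp [c, hy]
    have hcomp := (mdifferentiableAt_atlas_symm (I := I) (he y) hyc).comp y
      (mdifferentiableAt_atlas (chart_mem_atlas H y) (mem_chart_source H y))
    refine (hcomp.congr_of_eventuallyEq ?_).mdifferentiableWithinAt
    filter_upwards [c.open_source.mem_nhds (mem_chart_source H y)] with y' hy'
    exact congrArg e.symm (c.left_inv hy').symm

end Manifold

section Trivialization

variable {n d : ℕ} {M : Type*} [TopologicalSpace M] [ChartedSpace (Euc n) M]
  [IsManifold (𝓡 n) ∞ M] [ConnectedSpace M] {b : M}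
  {G : Type*} [Group G] [TopologicalSpace G] [ChartedSpace (Euc d) G] [LieGroup (𝓡 d) ∞ G]

namespace HolonomyMap

variable (H : HolonomyMap n d b G)

theorem mdifferentiable_localTriv (ψ : LocalFamily n b) :
    (H.localTriv ψ).MDifferentiable ((𝓡 n).prod (𝓡 d)) ((𝓡 n).prod (𝓡 d)) := by
  have : IsManifold (𝓡 d) ∞ G := ContMDiffMul.toIsManifold
  have : IsManifold (𝓡 d) 1 G := IsManifold.of_le (n := ∞) (by simp)
  have : IsManifold (𝓡 n) 1 M := IsManifold.of_le (n := ∞) (by simp)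
  have : IsManifold ((𝓡 n).prod (𝓡 d)) 1 H.Total := IsManifold.of_le (n := ∞) (by simp)
  exact mdifferentiable_of_trans_chartAt_mem_atlas fun z => ⟨ψ, _, chart_mem_atlas _ z, rfl⟩

/-- The differential of `C_ψ` at `(x,g)`. -/
noncomputable def trivDeriv (ψ : LocalFamily n b) (x : M) (g : G) :
    Euc n × Euc d →L[ℝ] Euc n × Euc d :=
  mfderiv ((𝓡 n).prod (𝓡 d)) ((𝓡 n).prod (𝓡 d)) (H.localTriv ψ).symm (x, g)

variable {ψ : LocalFamily n b} {x : M}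

theorem hasMFDerivAt_cls (hx : x ∈ ψ.U) (g : G) :
    HasMFDerivAt ((𝓡 n).prod (𝓡 d)) ((𝓡 n).prod (𝓡 d))
      (fun z : M × G => H.cls (ψ z.1) z.2) (x, g) (H.trivDeriv ψ x g) :=
  ((H.mdifferentiable_localTriv ψ).mdifferentiableAt_symm ⟨hx, trivial⟩).hasMFDerivAt

theorem bijective_trivDeriv (hx : x ∈ ψ.U) (g : G) : Function.Bijective (H.trivDeriv ψ x g) :=
  (H.mdifferentiable_localTriv ψ).symm.mfderiv_bijective ⟨hx, trivial⟩

theorem mfderiv_proj_trivDeriv (hx : x ∈ ψ.U) (g : G) (w : Euc n × Euc d) :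
    mfderiv ((𝓡 n).prod (𝓡 d)) (𝓡 n) H.proj (H.cls (ψ x) g) (H.trivDeriv ψ x g w) = w.1 := by
  have hxg : (x, g) ∈ (H.localTriv ψ).target := ⟨hx, trivial⟩
  have hproj : MDifferentiableAt ((𝓡 n).prod (𝓡 d)) (𝓡 n) H.proj (H.cls (ψ x) g) :=
    mdifferentiableAt_fst.comp _
      ((H.mdifferentiable_localTriv ψ).mdifferentiableAt ((H.localTriv ψ).map_target hxg))
  have hfst : H.proj ∘ (H.localTriv ψ).symm =ᶠ[𝓝 (x, g)] Prod.fst := by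
    filter_upwards [(H.localTriv ψ).open_target.mem_nhds hxg] with z hz
    exact ψ.tip z.1 hz.1
  have hderiv := hasMFDerivAt_unique (hproj.hasMFDerivAt.comp (x, g) (H.hasMFDerivAt_cls hx g))
    ((hasMFDerivAt_fst (x, g)).congr_of_eventuallyEq hfst)
  exact DFunLike.congr_fun hderiv w

theorem trivDeriv_mem_vertical_iff (hx : x ∈ ψ.U) (g : G) (w : Euc n × Euc d) :
    H.trivDeriv ψ x g w ∈ H.vertical (H.cls (ψ x) g) ↔ w.1 = 0 :=
  Eq.congr_left (H.mfderiv_proj_trivDeriv hx g w)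

theorem orbitDeriv_cls (hx : x ∈ ψ.U) (g : G) (ξ : GroupLieAlgebra (𝓡 d) G) :
    H.orbitDeriv (H.cls (ψ x) g) ξ =
      H.trivDeriv ψ x g (0, mfderiv (𝓡 d) (𝓡 d) (fun h : G => g * h) 1 ξ) := by
  have hmul : HasMFDerivAt (𝓡 d) (𝓡 d) (fun h : G => g * h) 1
      (mfderiv (𝓡 d) (𝓡 d) (fun h : G => g * h) 1) :=
    ((contMDiff_mul_left (I := 𝓡 d) (n := ∞)).mdifferentiableAt (by simp)).hasMFDerivAt
  have hcls : HasMFDerivAt ((𝓡 n).prod (𝓡 d)) ((𝓡 n).prod (𝓡 d))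
      (fun z : M × G => H.cls (ψ z.1) z.2) (x, g * 1) (H.trivDeriv ψ x g) := by
    rw [mul_one]
    exact H.hasMFDerivAt_cls hx g
  have hcomp := HasMFDerivAt.comp (f := fun h : G => (x, g * h)) 1 hcls
    ((hasMFDerivAt_const x (1 : G)).prodMk hmul)
  exact DFunLike.congr_fun hcomp.mfderiv ξ

end HolonomyMap

end Trivialization

section StraightFamily

variable {n d : ℕ} {M : Type*} [TopologicalSpace M] [ChartedSpace (Euc n) M] {b : M}

/-- The family `ψ` consists of the prolongations of the path `p` by straight segments in the
coordinates `φ`. -/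
structure LocalFamily.IsStraight (ψ : LocalFamily n b) (φ : OpenPartialHomeomorph M (Euc n))
    (p : BasedPath n b) : Prop where
  mem : p 1 ∈ ψ.U
  subset : ψ.U ⊆ φ.source
  eq : ∀ u ∈ ψ.U, (ψ u : unitInterval → M) = straightPath φ (φ u) (φ (p 1)) ⊙ p

theorem LocalFamily.exists_isStraight {φ : OpenPartialHomeomorph M (Euc n)}
    (hφ : φ ∈ IsManifold.maximalAtlas (𝓡 n) ∞ M) {p : BasedPath n b} (hp : p 1 ∈ φ.source) :
    ∃ ψ : LocalFamily n b, ψ.IsStraight φ p := by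
  classical
  obtain ⟨ε, hε, hball⟩ := Metric.isOpen_iff.1 φ.open_target (φ (p 1)) (φ.map_source hp)
  have hstar := (convex_ball (φ (p 1)) ε).starConvex (Metric.mem_ball_self hε)
  let U := φ.source ∩ φ ⁻¹' Metric.ball (φ (p 1)) ε
  have hfam : SmoothFamilyOn n (𝓡 n) U fun u => straightPath φ (φ u) (φ (p 1)) ⊙ p :=
    (smoothFamilyOn_straightPath hφ hstar hball
      ((contMDiffOn_of_mem_maximalAtlas hφ).mono inter_subset_left)
      (fun u hu => hu.2)).pcomp (SmoothFamilyOn.const p.smooth U)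
      fun u _ => (straightPath_zero hp _).symm
  refine ⟨⟨U, φ.isOpen_inter_preimage Metric.isOpen_ball, fun u => if hu : u ∈ U then
    ⟨_, hfam.piecewiseSmooth hu, by simp [p.source]⟩ else constPath n b,
    hfam.congr fun u hu => by simp only [dif_pos hu], fun u hu => ?_⟩,
    ⟨hp, Metric.mem_ball_self hε⟩, inter_subset_left, fun u hu => ?_⟩
  · simp [dif_pos hu, straightPath_one, φ.left_inv hu.1]
  · exact congrArg BasedPath.toFun (dif_pos hu)

theorem LocalFamily.exists_chart_isStraight [IsManifold (𝓡 n) ∞ M] (p : BasedPath n b) :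
    ∃ φ ∈ IsManifold.maximalAtlas (𝓡 n) ∞ M, ∃ ψ : LocalFamily n b, ψ.IsStraight φ p :=
  have hφ := IsManifold.chart_mem_maximalAtlas (p 1)
  ⟨_, hφ, LocalFamily.exists_isStraight hφ (mem_chart_source (Euc n) (p 1))⟩

variable {G : Type*} [Group G] [TopologicalSpace G] [ChartedSpace (Euc d) G]
  (H : HolonomyMap n d b G) {ψ : LocalFamily n b}

namespace HolonomyMap

theorem cls_eq_cls_localFamily {p : BasedPath n b} (hp : p 1 ∈ ψ.U) (g : G) :
    H.cls p g = H.cls (ψ (p 1)) (H.val (pinv p ⊙ ψ (p 1)) * g) :=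
  H.cls_eq_cls.2 ⟨(ψ.tip _ hp).symm, rfl⟩

end HolonomyMap

namespace LocalFamily.IsStraight

variable {φ : OpenPartialHomeomorph M (Euc n)} {p : BasedPath n b}

theorem val_eq_one (hψ : ψ.IsStraight φ p) : H.val (pinv p ⊙ ψ (p 1)) = 1 := by
  have hthin := isThin_pinv_pcomp_cancel p.smooth.1 (continuous_const (y := p 1)) rfl
  rw [hψ.eq _ hψ.mem, straightPath_self, φ.left_inv (hψ.subset hψ.mem)]
  rw [show pinv (fun _ => p 1) = fun _ => p 1 from rfl, pcomp_const] at hthin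
  exact H.val_thin hthin

theorem cls_eq (hψ : ψ.IsStraight φ p) (g : G) : H.cls (ψ (p 1)) g = H.cls p g := by
  rw [H.cls_eq_cls_localFamily hψ.mem, hψ.val_eq_one, one_mul]

end LocalFamily.IsStraight

theorem HolonomyMap.exists_isStraight_cls_eq [IsManifold (𝓡 n) ∞ M] (a : H.Total) :
    ∃ (p : BasedPath n b) (φ : OpenPartialHomeomorph M (Euc n)) (ψ : LocalFamily n b) (g : G),
      φ ∈ IsManifold.maximalAtlas (𝓡 n) ∞ M ∧ ψ.IsStraight φ p ∧ H.cls (ψ (p 1)) g = a := by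
  obtain ⟨⟨p, g⟩, rfl⟩ := H.exists_rep a
  obtain ⟨φ, hφ, ψ, hψ⟩ := LocalFamily.exists_chart_isStraight p
  exact ⟨p, φ, ψ, g, hφ, hψ, hψ.cls_eq H g⟩

end StraightFamily

section Curves

variable {E : Type*} [NormedAddCommGroup E] [NormedSpace ℝ E]

theorem exists_contDiff_curve_mem_ball (x u : E) (j : ℝ) {ε : ℝ} (hε : 0 < ε) :
    ∃ l : ℝ → E, ContDiff ℝ ∞ l ∧ l j = x ∧ HasDerivAt l u j ∧ ∀ t, l t ∈ Metric.ball x ε := by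
  let δ := ε / (‖u‖ + 1)
  have hδ : 0 < δ := by positivity
  have hsin : HasDerivAt (fun t => δ * Real.sin ((t - j) / δ)) 1 j := by
    simpa [hδ.ne'] using (((hasDerivAt_id j).sub_const j).div_const δ).sin.const_mul δ
  refine ⟨fun t => x + (δ * Real.sin ((t - j) / δ)) • u, by fun_prop, by simp, ?_, fun t => ?_⟩
  · simpa only [one_smul] using (hsin.smul_const u).const_add x
  · rw [mem_ball_iff_norm, add_sub_cancel_left, norm_smul, norm_mul, Real.norm_of_nonneg hδ.le]
    have hsin_le : ‖Real.sin ((t - j) / δ)‖ ≤ 1 := Real.abs_sin_le_one _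
    calc δ * ‖Real.sin ((t - j) / δ)‖ * ‖u‖ ≤ δ * 1 * ‖u‖ := by gcongr
      _ < δ * (‖u‖ + 1) := by rw [mul_one]; gcongr; exact lt_add_one _
      _ = ε := div_mul_cancel₀ _ (by positivity)

theorem exists_contMDiff_curve {X : Type*} [TopologicalSpace X] [ChartedSpace E X]
    [IsManifold 𝓘(ℝ, E) ∞ X] (x : X) (v : E) (j : ℝ) :
    ∃ k : ℝ → X, ContMDiff 𝓘(ℝ, ℝ) 𝓘(ℝ, E) ∞ k ∧ k j = x ∧
      HasMFDerivAt 𝓘(ℝ, ℝ) 𝓘(ℝ, E) k j (ContinuousLinearMap.toSpanSingleton ℝ v) := by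
  have : IsManifold 𝓘(ℝ, E) 1 X := IsManifold.of_le (n := ∞) (by simp)
  let c := chartAt E x
  have hc : c.MDifferentiable 𝓘(ℝ, E) 𝓘(ℝ, E) := mdifferentiable_chart x
  have hx : c x ∈ c.target := mem_chart_target E x
  let D : E →L[ℝ] E := mfderiv 𝓘(ℝ, E) 𝓘(ℝ, E) c.symm (c x)
  obtain ⟨(u : E), hu : D u = v⟩ := hc.symm.mfderiv_surjective hx v
  obtain ⟨ε, hε, hball⟩ := Metric.isOpen_iff.1 c.open_target (c x) hx
  obtain ⟨l, hl, hlj, hl', hl_mem⟩ := exists_contDiff_curve_mem_ball (c x) u j hε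
  have hcl : HasMFDerivAt 𝓘(ℝ, E) 𝓘(ℝ, E) c.symm (l j) D := by
    rw [hlj]
    exact (hc.mdifferentiableAt_symm hx).hasMFDerivAt
  refine ⟨c.symm ∘ l, ?_, by simp [hlj, c], ?_⟩
  · rw [← contMDiffOn_univ]
    exact (contMDiffOn_chart_symm (H := E) (x := x)).comp hl.contMDiff.contMDiffOn
      fun t _ => hball (hl_mem t)
  · refine (hcl.comp j hl'.hasFDerivAt.hasMFDerivAt).congr_mfderiv ?_
    exact (D.comp_toSpanSingleton u).trans (congrArg _ hu)

variable {n : ℕ} {M : Type*} [TopologicalSpace M] [ChartedSpace (Euc n) M]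
  [IsManifold (𝓡 n) ∞ M] [ConnectedSpace M] {b : M}

theorem exists_basedPath_eqOn {k : ℝ → M} (hk : ContMDiff 𝓘(ℝ, ℝ) (𝓡 n) ∞ k) :
    ∃ r : BasedPath n b, EqOn (IccExtend zero_le_one r) k (Ioo (1 / 2) 1) := by
  obtain ⟨p, hp⟩ := exists_basedPath (n := n) (b := b) (k (1 / 2))
  have haffine : ContMDiff (𝓘(ℝ, ℝ).prod 𝓘(ℝ, ℝ)) 𝓘(ℝ, ℝ) ∞ fun z : ℝ × ℝ => (1 + z.2) / 2 :=
    (contMDiff_const.add contMDiff_snd).div_const 2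
  let s : unitInterval → M := fun t => k ((1 + t) / 2)
  have hs : PiecewiseSmooth n s :=
    (smoothFamilyOn_of_contMDiffOn (hk.comp haffine).contMDiffOn).piecewiseSmooth (mem_univ 0)
  refine ⟨p.prolong s hs (by simp [s, hp]), fun t ht => ?_⟩
  have ht' : t ∈ Icc (0 : ℝ) 1 := ⟨by linarith [ht.1], ht.2.le⟩
  rw [IccExtend_of_mem _ _ ht']
  simp only [BasedPath.prolong, pcomp, if_neg ht.1.not_ge]
  rw [IccExtend_of_mem _ _ ⟨by linarith [ht.1], by linarith [ht.2]⟩]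
  simp [s]

theorem exists_basedPath_hasMFDerivAt (x : M) (v : Euc n) :
    ∃ (r : BasedPath n b) (j : ℝ), j ∈ Ioo (0 : ℝ) 1 ∧
      (∀ᶠ t in 𝓝 j, ContMDiffAt 𝓘(ℝ, ℝ) (𝓡 n) ∞ (IccExtend zero_le_one r) t) ∧
      IccExtend zero_le_one r j = x ∧
      HasMFDerivAt 𝓘(ℝ, ℝ) (𝓡 n) (IccExtend zero_le_one r) j
        (ContinuousLinearMap.toSpanSingleton ℝ v) := by
  let j : ℝ := 3 / 4
  have hj : j ∈ Ioo (1 / 2 : ℝ) 1 := ⟨by norm_num [j], by norm_num [j]⟩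
  obtain ⟨k, hk, hkj, hk'⟩ := exists_contMDiff_curve x v j
  obtain ⟨r, hr⟩ := exists_basedPath_eqOn (b := b) hk
  have hrk : IccExtend zero_le_one r =ᶠ[𝓝 j] k := hr.eventuallyEq_of_mem (Ioo_mem_nhds hj.1 hj.2)
  exact ⟨r, j, ⟨one_half_pos.trans hj.1, hj.2⟩,
    hrk.eventuallyEq_nhds.mono fun t ht => hk.contMDiffAt.congr_of_eventuallyEq ht,
    (hr hj).trans hkj, hk'.congr_of_eventuallyEq hrk⟩

end Curves

section Splitting

variable {n d : ℕ} {M : Type*} [TopologicalSpace M] [ChartedSpace (Euc n) M]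
  {b : M}
  {G : Type*} [Group G] [TopologicalSpace G] [ChartedSpace (Euc d) G] [LieGroup (𝓡 d) ∞ G]

namespace HolonomyMap

variable (H : HolonomyMap n d b G) {ψ : LocalFamily n b} {φ : OpenPartialHomeomorph M (Euc n)}
  {p : BasedPath n b} {r : unitInterval → M} {j : ℝ} {χ : ℝ → BasedPath n b} {γ : ℝ → G}

theorem hasMFDerivAt_val_localFamily_iff (hφ : φ ∈ IsManifold.maximalAtlas (𝓡 n) ∞ M)
    (hψ : ψ.IsStraight φ p) (hr : PiecewiseSmooth n r) (hj : j ∈ Ioo (0 : ℝ) 1)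
    (hrj : ∀ᶠ t in 𝓝 j, ContMDiffAt 𝓘(ℝ, ℝ) (𝓡 n) ∞ (IccExtend zero_le_one r) t)
    (hp : p 1 = IccExtend zero_le_one r j) (hχ : ∀ᶠ i in 𝓝 j, χ i 1 = IccExtend zero_le_one r i)
    {D : ℝ →L[ℝ] Euc d} :
    HasMFDerivAt 𝓘(ℝ, ℝ) (𝓡 d)
      (fun i => H.val (pinv (χ i) ⊙ ψ (IccExtend zero_le_one r i)) * γ i) j D ↔
    HasMFDerivAt 𝓘(ℝ, ℝ) (𝓡 d)
      (fun i => H.val (pinv (χ i) ⊙ (pathBetween r j i ⊙ p)) * γ i) j D := by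
  let R := IccExtend zero_le_one r
  let f i := H.val (pinv (χ i) ⊙ (pathBetween r j i ⊙ p)) * γ i
  let q i := H.val (pinv (pathBetween r j i ⊙ p) ⊙ (straightPath φ (φ (R i)) (φ (p 1)) ⊙ p))
  have hRU : ∀ᶠ i in 𝓝 j, R i ∈ ψ.U :=
    hrj.self_of_nhds.continuousAt.eventually (ψ.isOpen.mem_nhds (hp ▸ hψ.mem))
  have hfactor : (fun i => H.val (pinv (χ i) ⊙ ψ (R i)) * γ i) =ᶠ[𝓝 j] fun i => q i * f i := by
    filter_upwards [hχ, hRU] with i hχi hi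
    let t := p.prolong (pathBetween r j i) (hr.pathBetween j i) (by rw [pathBetween_zero, hp])
    have ht : t 1 = R i := (pcomp_one _ _).trans (pathBetween_one r j i)
    have htrans := H.val_trans (p := χ i) (q := t) (r := ψ (R i)) (ht.trans hχi.symm)
      ((ψ.tip _ hi).trans hχi.symm)
    simp only [q, f]
    rw [← mul_assoc, ← htrans, hψ.eq _ hi]
    rfl
  have hqj : q j = 1 := by
    have hself := H.val_pathBetween_self hr (q := ψ (p 1)) hp (ψ.tip _ hψ.mem)
    rw [hψ.val_eq_one, hψ.eq _ hψ.mem] at hself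
    simp only [q, R, ← hp, hself]
  have hiff : HasMFDerivAt 𝓘(ℝ, ℝ) (𝓡 d) (fun i => q i * f i) j D ↔
      HasMFDerivAt 𝓘(ℝ, ℝ) (𝓡 d) f j D :=
    hasMFDerivAt_mul_iff_of_zero hqj
      (H.hasMFDerivAt_val_pathBetween p hφ (hψ.subset hψ.mem) hr hj hrj hp)
  exact ⟨fun h => hiff.1 (h.congr_of_eventuallyEq hfactor.symm),
    fun h => (hiff.2 h).congr_of_eventuallyEq hfactor⟩

variable [IsManifold (𝓡 n) ∞ M] [ConnectedSpace M] {g : G}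

theorem hasMFDerivAt_cls_curve {x : M} (hx : x ∈ ψ.U)
    (hcls : H.cls (χ j) (γ j) = H.cls (ψ x) g) {R : ℝ → M} (hχ : ∀ᶠ i in 𝓝 j, χ i 1 = R i)
    {v : ℝ →L[ℝ] Euc n} (hv : HasMFDerivAt 𝓘(ℝ, ℝ) (𝓡 n) R j v) {η : ℝ →L[ℝ] Euc d}
    (hη : HasMFDerivAt 𝓘(ℝ, ℝ) (𝓡 d) (fun i => H.val (pinv (χ i) ⊙ ψ (R i)) * γ i) j η) :
    HasMFDerivAt 𝓘(ℝ, ℝ) ((𝓡 n).prod (𝓡 d)) (fun i => H.cls (χ i) (γ i)) j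
      ((H.trivDeriv ψ x g).comp (v.prod η)) := by
  obtain ⟨htip, rfl⟩ := H.cls_eq_cls.1 hcls
  obtain rfl : R j = x := by rw [← hχ.self_of_nhds, htip, ψ.tip _ hx]
  refine (HasMFDerivAt.comp (f := fun i => (R i, H.val (pinv (χ i) ⊙ ψ (R i)) * γ i)) j
    (H.hasMFDerivAt_cls hx _) (hv.prodMk hη)).congr_of_eventuallyEq ?_
  filter_upwards [hχ, hv.continuousAt.eventually (ψ.isOpen.mem_nhds hx)] with i hχi hi
  have hcls_i := H.cls_eq_cls_localFamily (ψ := ψ) (p := χ i) (by rwa [hχi]) (γ i)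
  rwa [hχi] at hcls_i

theorem hasMFDerivAt_cls_contr (hφ : φ ∈ IsManifold.maximalAtlas (𝓡 n) ∞ M)
    (hψ : ψ.IsStraight φ p) {r : BasedPath n b} {h : G} (hj : j ∈ Ioo (0 : ℝ) 1)
    (hrj : ∀ᶠ t in 𝓝 j, ContMDiffAt 𝓘(ℝ, ℝ) (𝓡 n) ∞ (IccExtend zero_le_one r) t)
    (hcls : H.cls (r.contr (projIcc 0 1 zero_le_one j)) h = H.cls (ψ (p 1)) g)
    {v : ℝ →L[ℝ] Euc n} (hv : HasMFDerivAt 𝓘(ℝ, ℝ) (𝓡 n) (IccExtend zero_le_one r) j v) :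
    HasMFDerivAt 𝓘(ℝ, ℝ) ((𝓡 n).prod (𝓡 d))
      (fun i => H.cls (r.contr (projIcc 0 1 zero_le_one i)) h) j
      ((H.trivDeriv ψ (p 1) g).comp (v.prod 0)) := by
  have hp : r.contr (projIcc 0 1 zero_le_one j) 1 = p 1 :=
    (H.cls_eq_cls.1 hcls).1.trans (ψ.tip _ hψ.mem)
  have hχ := Eventually.of_forall (f := 𝓝 j) r.contr_one
  refine H.hasMFDerivAt_cls_curve hψ.mem hcls hχ hv ((H.hasMFDerivAt_val_localFamily_iff hφ hψ
    r.smooth hj hrj (hp.symm.trans (r.contr_one j)) hχ).2 ?_)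
  refine (hasMFDerivAt_const (H.val (pinv (r.contr (projIcc 0 1 zero_le_one j)) ⊙ p) * h)
    j).congr_of_eventuallyEq (Eventually.of_forall fun i => ?_)
  exact congrArg (· * h) (H.val_transport (α := r.contr (projIcc 0 1 zero_le_one i)) hp)

theorem trivDeriv_mem_horizontal (hφ : φ ∈ IsManifold.maximalAtlas (𝓡 n) ∞ M)
    (hψ : ψ.IsStraight φ p) (g : G) (v : Euc n) :
    H.trivDeriv ψ (p 1) g (v, 0) ∈ H.horizontal (H.cls (ψ (p 1)) g) := by
  obtain ⟨r, j, hj, hrj, hp, hv⟩ := exists_basedPath_hasMFDerivAt (b := b) (p 1) v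
  let q := r.contr (projIcc 0 1 zero_le_one j)
  have hq : q 1 = p 1 := (r.contr_one j).trans hp
  have hcls : H.cls q ((H.val (pinv q ⊙ ψ (p 1)))⁻¹ * g) = H.cls (ψ (p 1)) g :=
    H.cls_eq_cls.2 ⟨hq.trans (ψ.tip _ hψ.mem).symm, (mul_inv_cancel_left _ _).symm⟩
  refine Submodule.subset_span ⟨r, j, _, hj, hrj, hcls, ?_⟩
  rw [velocity, (H.hasMFDerivAt_cls_contr hφ hψ hj hrj hcls hv).mfderiv]
  exact congrArg (fun w => H.trivDeriv ψ (p 1) g (w, 0)) (one_smul ℝ v).symm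

theorem exists_trivDeriv_eq_of_mem_horizontal (hφ : φ ∈ IsManifold.maximalAtlas (𝓡 n) ∞ M)
    (hψ : ψ.IsStraight φ p) {X : TangentSpace ((𝓡 n).prod (𝓡 d)) (H.cls (ψ (p 1)) g)}
    (hX : X ∈ H.horizontal (H.cls (ψ (p 1)) g)) :
    ∃ v, X = H.trivDeriv ψ (p 1) g (v, 0) := by
  let T := H.trivDeriv ψ (p 1) g
  refine Submodule.span_induction
    (M := TangentSpace ((𝓡 n).prod (𝓡 d)) (H.cls (ψ (p 1)) g))
    (p := fun X _ => ∃ v, X = T (v, 0)) ?_ ⟨0, (map_zero T).symm⟩ ?_ ?_ hX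
  · rintro X ⟨r, j, h, hj, hrj, hcls, rfl⟩
    have hv := (hrj.self_of_nhds.mdifferentiableAt (by simp)).hasMFDerivAt
    refine ⟨mfderiv 𝓘(ℝ, ℝ) (𝓡 n) (IccExtend zero_le_one (r : unitInterval → M)) j (1 : ℝ), ?_⟩
    rw [velocity, (H.hasMFDerivAt_cls_contr hφ hψ hj hrj hcls hv).mfderiv]
    rfl
  · rintro X Y - - ⟨v, rfl⟩ ⟨w, rfl⟩
    have hadd : T (v, 0) + T (w, 0) = T (v + w, 0) := by
      rw [← map_add, Prod.mk_add_mk, add_zero]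
    exact ⟨v + w, hadd⟩
  · rintro c X - ⟨v, rfl⟩
    have hsmul : c • T (v, 0) = T (c • v, 0) := by
      rw [← map_smul, Prod.smul_mk, smul_zero]
    exact ⟨c • v, hsmul⟩

theorem trivDeriv_mem_horizontal_iff (hφ : φ ∈ IsManifold.maximalAtlas (𝓡 n) ∞ M)
    (hψ : ψ.IsStraight φ p) (g : G) (w : Euc n × Euc d) :
    H.trivDeriv ψ (p 1) g w ∈ H.horizontal (H.cls (ψ (p 1)) g) ↔ w.2 = 0 := by
  refine ⟨fun hw => ?_, fun hw => ?_⟩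
  · obtain ⟨v, hv⟩ := H.exists_trivDeriv_eq_of_mem_horizontal hφ hψ hw
    exact congrArg Prod.snd ((H.bijective_trivDeriv hψ.mem g).1 hv)
  · rw [show w = (w.1, 0) from Prod.ext rfl hw]
    exact H.trivDeriv_mem_horizontal hφ hψ g w.1

end HolonomyMap

end Splitting

section Connection

variable {n d : ℕ} {M : Type*} [TopologicalSpace M] [ChartedSpace (Euc n) M]
  [IsManifold (𝓡 n) ∞ M] [ConnectedSpace M] {b : M}
  {G : Type*} [Group G] [TopologicalSpace G] [ChartedSpace (Euc d) G] [LieGroup (𝓡 d) ∞ G]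

namespace HolonomyMap

variable (H : HolonomyMap n d b G)

theorem isCompl_vertical_horizontal (a : H.Total) : IsCompl (H.vertical a) (H.horizontal a) := by
  obtain ⟨p, φ, ψ, g, hφ, hψ, rfl⟩ := H.exists_isStraight_cls_eq a
  let T := H.trivDeriv ψ (p 1) g
  have hT := H.bijective_trivDeriv hψ.mem g
  have hvert := H.trivDeriv_mem_vertical_iff hψ.mem g
  have hhor := H.trivDeriv_mem_horizontal_iff hφ hψ g
  refine ⟨Submodule.disjoint_def.2 fun X hXv hXh => ?_,
    Submodule.codisjoint_iff_exists_add_eq.2 fun X => ?_⟩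
  · obtain ⟨w, rfl⟩ := hT.2 X
    obtain rfl : w = 0 := Prod.ext ((hvert w).1 hXv) ((hhor w).1 hXh)
    exact map_zero T
  · obtain ⟨⟨v, η⟩, rfl⟩ := hT.2 X
    have hadd : T (0, η) + T (v, 0) = T (v, η) := by
      rw [← map_add, Prod.mk_add_mk, add_zero, zero_add]
    exact ⟨T (0, η), T (v, 0), (hvert _).2 rfl, (hhor _).2 rfl, hadd⟩

theorem injective_orbitDeriv (a : H.Total) : Function.Injective (H.orbitDeriv a) := by
  obtain ⟨p, φ, ψ, g, -, hψ, rfl⟩ := H.exists_isStraight_cls_eq a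
  have hmul : Function.LeftInverse (mfderiv (𝓡 d) (𝓡 d) (fun h : G => g⁻¹ * h) g)
      (mfderiv (𝓡 d) (𝓡 d) (fun h : G => g * h) 1) :=
    mfderiv_inv_mul_mfderiv_mul (E := Euc d) (mul_one g)
  intro ξ ξ' hξ
  rw [H.orbitDeriv_cls hψ.mem, H.orbitDeriv_cls hψ.mem] at hξ
  exact hmul.injective (congrArg Prod.snd ((H.bijective_trivDeriv hψ.mem g).1 hξ))

variable {p : BasedPath n b} {φ : OpenPartialHomeomorph M (Euc n)} {ψ : LocalFamily n b}
  {a : H.Total} {g : G}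

theorem orbitDeriv_mfderiv_inv_mul {x : M} (hx : x ∈ ψ.U) (ha : H.cls (ψ x) g = a) (η : Euc d) :
    H.orbitDeriv a (mfderiv (𝓡 d) (𝓡 d) (fun h : G => g⁻¹ * h) g η) =
      H.trivDeriv ψ x g (0, η) := by
  subst ha
  have hmul := mfderiv_inv_mul_mfderiv_mul (I := 𝓡 d) (inv_mul_cancel g) η
  rw [inv_inv] at hmul
  exact (H.orbitDeriv_cls hx g _).trans
    (congrArg (fun ζ : Euc d => H.trivDeriv ψ x g (0, ζ)) hmul)

theorem range_orbitDeriv (a : H.Total) : range (H.orbitDeriv a) = H.vertical a := by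
  obtain ⟨p, φ, ψ, g, -, hψ, rfl⟩ := H.exists_isStraight_cls_eq a
  have hvert := H.trivDeriv_mem_vertical_iff hψ.mem g
  apply Subset.antisymm
  · rintro _ ⟨ξ, rfl⟩
    rw [H.orbitDeriv_cls hψ.mem]
    exact (hvert _).2 rfl
  · intro X hX
    obtain ⟨⟨v, η⟩, rfl⟩ := (H.bijective_trivDeriv hψ.mem g).2 X
    obtain rfl : v = 0 := (hvert _).1 hX
    exact ⟨_, H.orbitDeriv_mfderiv_inv_mul hψ.mem rfl η⟩

theorem vertProj_trivDeriv (hφ : φ ∈ IsManifold.maximalAtlas (𝓡 n) ∞ M)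
    (hψ : ψ.IsStraight φ p) (ha : H.cls (ψ (p 1)) g = a) (v : Euc n) (η : Euc d) :
    H.vertProj a (H.trivDeriv ψ (p 1) g (v, η)) = H.trivDeriv ψ (p 1) g (0, η) := by
  subst ha
  let a := H.cls (ψ (p 1)) g
  let T := H.trivDeriv ψ (p 1) g
  have hc := H.isCompl_vertical_horizontal a
  let P := (H.vertical a).projectionOnto (H.horizontal a) hc
  have hvert : T (0, η) ∈ H.vertical a := (H.trivDeriv_mem_vertical_iff hψ.mem g _).2 rfl
  have hhor : T (v, 0) ∈ H.horizontal a := (H.trivDeriv_mem_horizontal_iff hφ hψ g _).2 rfl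
  have hP : P (T (v, η)) = ⟨T (0, η), hvert⟩ := calc
    P (T (v, η)) = P (T (0, η)) + P (T (v, 0)) := by
      rw [show T (v, η) = T (0, η) + T (v, 0) by
        rw [← map_add, Prod.mk_add_mk, add_zero, zero_add]]
      exact map_add P _ _
    _ = ⟨T (0, η), hvert⟩ := by
      rw [Submodule.projectionOnto_apply_of_mem_left hc hvert,
        Submodule.projectionOnto_apply_of_mem_right hc hhor, add_zero]
  exact (dif_pos hc).trans (congrArg Subtype.val hP)

theorem connForm_trivDeriv (hφ : φ ∈ IsManifold.maximalAtlas (𝓡 n) ∞ M)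
    (hψ : ψ.IsStraight φ p) (ha : H.cls (ψ (p 1)) g = a) (v : Euc n) (η : Euc d) :
    H.connForm a (H.trivDeriv ψ (p 1) g (v, η)) =
      mfderiv (𝓡 d) (𝓡 d) (fun h : G => g⁻¹ * h) g η :=
  (congrArg (Function.invFun (H.orbitDeriv a)) ((H.vertProj_trivDeriv hφ hψ ha v η).trans
    (H.orbitDeriv_mfderiv_inv_mul hψ.mem ha η).symm)).trans
      (Function.leftInverse_invFun (H.injective_orbitDeriv a) _)

end HolonomyMap

end Connection

section Velocity

variable {n d : ℕ} {M : Type*} [TopologicalSpace M] [ChartedSpace (Euc n) M] {b : M}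
  {G : Type*} [Group G] [TopologicalSpace G] [ChartedSpace (Euc d) G]
  {ψ : LocalFamily n b} {j : ℝ}

theorem LocalFamily.exists_smoothFamilyOn_along {r : BasedPath n b}
    (hrj : ∀ᶠ t in 𝓝 j, ContMDiffAt 𝓘(ℝ, ℝ) (𝓡 n) ∞ (IccExtend zero_le_one r) t)
    (hj : IccExtend zero_le_one r j ∈ ψ.U) :
    ∃ χ : ℝ → BasedPath n b, (∀ i, χ i 1 = IccExtend zero_le_one r i) ∧
      ∃ V : Set ℝ, IsOpen V ∧ j ∈ V ∧
        SmoothFamilyOn n 𝓘(ℝ, ℝ) V (fun i => (χ i : unitInterval → M)) ∧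
        ∀ i ∈ V, χ i = ψ (IccExtend zero_le_one r i) := by
  classical
  let R := IccExtend zero_le_one r
  have hRU : ∀ᶠ i in 𝓝 j, R i ∈ ψ.U :=
    hrj.self_of_nhds.continuousAt.eventually (ψ.isOpen.mem_nhds hj)
  obtain ⟨V, hV, hV_open, hjV⟩ := eventually_nhds_iff.1 (hrj.and hRU)
  have hχ : ∀ i ∈ V, (if R i ∈ ψ.U then ψ (R i) else r.contr (projIcc 0 1 zero_le_one i)) =
      ψ (R i) := fun i hi => if_pos (hV i hi).2
  refine ⟨_, fun i => ?_, V, hV_open, hjV, ?_, hχ⟩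
  · split_ifs with hi
    · exact ψ.tip _ hi
    · exact r.contr_one i
  · exact (ψ.smooth.comp (fun i hi => (hV i hi).1.contMDiffWithinAt) fun i hi =>
      (hV i hi).2).congr fun i hi => congrArg BasedPath.toFun (hχ i hi)

theorem HolonomyMap.exists_eq_velocity [IsManifold (𝓡 n) ∞ M] [ConnectedSpace M]
    [LieGroup (𝓡 d) ∞ G] (H : HolonomyMap n d b G) (a : H.Total)
    (X : TangentSpace ((𝓡 n).prod (𝓡 d)) a) :
    ∃ (χ : ℝ → BasedPath n b) (γ : ℝ → G) (j : ℝ), SmoothNear d χ γ j ∧ χ 0 1 = b ∧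
      H.cls (χ j) (γ j) = a ∧ X = H.velocity (fun i => H.cls (χ i) (γ i)) j := by
  have : IsManifold (𝓡 d) ∞ G := ContMDiffMul.toIsManifold
  obtain ⟨p, φ, ψ, g, -, hψ, rfl⟩ := H.exists_isStraight_cls_eq a
  obtain ⟨⟨v, η⟩, rfl⟩ := (H.bijective_trivDeriv hψ.mem g).2 X
  obtain ⟨r, j, hj, hrj, hrp, hr⟩ := exists_basedPath_hasMFDerivAt (b := b) (p 1) v
  obtain ⟨γ, hγ, hγj, hγ'⟩ := exists_contMDiff_curve (E := Euc d) g η j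
  obtain ⟨χ, htip, V, hV, hjV, hχV, hχ⟩ :=
    LocalFamily.exists_smoothFamilyOn_along hrj (hrp ▸ hψ.mem)
  have hcls : H.cls (χ j) (γ j) = H.cls (ψ (p 1)) g := by rw [hχ j hjV, hrp, hγj]
  have hcoord : (fun i => H.val (pinv (χ i) ⊙ ψ (IccExtend zero_le_one r i)) * γ i) =ᶠ[𝓝 j] γ := by
    filter_upwards [hV.mem_nhds hjV] with i hi
    rw [hχ i hi, H.val_self, one_mul]
  have hcurve := H.hasMFDerivAt_cls_curve hψ.mem hcls (Eventually.of_forall htip) hr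
    (hγ'.congr_of_eventuallyEq hcoord)
  refine ⟨χ, γ, j, ⟨hj, ?_, V, hV, hjV, hχV, hγ.contMDiffOn⟩, ?_, hcls, ?_⟩
  · simpa only [htip, IccExtend_val] using r.smooth
  · exact (htip 0).trans ((IccExtend_left _ _).trans r.source)
  · rw [velocity, hcurve.mfderiv]
    exact congrArg (H.trivDeriv ψ (p 1) g) (one_smul ℝ (v, η)).symm

end Velocity

section HolonomyFormula

variable {n d : ℕ} {M : Type*} [TopologicalSpace M] [ChartedSpace (Euc n) M] {b : M}
  {G : Type*} [TopologicalSpace G] [ChartedSpace (Euc d) G]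
  {χ : ℝ → BasedPath n b} {γ : ℝ → G} {j : ℝ}

namespace SmoothNear

theorem eventually_tip (h : SmoothNear d χ γ j) :
    ∀ᶠ i in 𝓝 j, χ i 1 = IccExtend zero_le_one (fun i : unitInterval => χ i 1) i := by
  filter_upwards [Ioo_mem_nhds h.1.1 h.1.2] with i hi
  rw [IccExtend_of_mem _ _ (Ioo_subset_Icc_self hi)]

theorem eventually_contMDiffAt_tip (h : SmoothNear d χ γ j) :
    ∀ᶠ t in 𝓝 j, ContMDiffAt 𝓘(ℝ, ℝ) (𝓡 n) ∞
      (IccExtend zero_le_one fun i : unitInterval => χ i 1) t := by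
  obtain ⟨V, hV, hjV, hχV, -⟩ := h.2.2
  filter_upwards [h.eventually_tip.eventually_nhds, hV.mem_nhds hjV] with t htip ht
  exact (hχV.contMDiffOn_one.contMDiffAt (hV.mem_nhds ht)).congr_of_eventuallyEq
    (EventuallyEq.symm htip)

variable {ψ : LocalFamily n b} [Group G] [LieGroup (𝓡 d) ∞ G]

theorem mdifferentiableAt_val (h : SmoothNear d χ γ j) (H : HolonomyMap n d b G)
    (hj : χ j 1 ∈ ψ.U) :
    MDifferentiableAt 𝓘(ℝ, ℝ) (𝓡 d) (fun i => H.val (pinv (χ i) ⊙ ψ (χ i 1)) * γ i) j := by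
  obtain ⟨V, hV, hjV, hχV, hγV⟩ := h.2.2
  have htip := hχV.contMDiffOn_one
  let W := V ∩ (fun i => χ i 1) ⁻¹' ψ.U
  have hW : IsOpen W := htip.continuousOn.isOpen_inter_preimage hV ψ.isOpen
  have hWV : W ⊆ V := inter_subset_left
  have hloops : SmoothFamilyOn n 𝓘(ℝ, ℝ) W fun i => pinv (χ i) ⊙ ψ (χ i 1) :=
    (hχV.mono hWV).pinv.pcomp (ψ.smooth.comp (htip.mono hWV) fun i hi => hi.2)
      fun i hi => by simp [ψ.tip _ hi.2]
  have hval := H.contMDiffOn_val_space hW hloops (fun i _ => by simp [(ψ _).source])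
    fun i _ => by simp [(χ i).source]
  exact ((hval.mul (hγV.mono hWV)).contMDiffAt (hW.mem_nhds ⟨hjV, hj⟩)).mdifferentiableAt (by simp)

end SmoothNear

namespace HolonomyMap

variable [Group G] (H : HolonomyMap n d b G)

/-- The fibre coordinate of `{χ[i],γ(i)}` relative to the prolongation of `χ[j]` along the curve
`i ↦ χ[i](1)` of end points, from the parameter `j` to the parameter `i`. -/
noncomputable def relCoord (χ : ℝ → BasedPath n b) (γ : ℝ → G) (j i : ℝ) : G :=
  H.val (pinv (χ i) ⊙ (pathBetween (fun i : unitInterval => χ i 1) j i ⊙ χ j)) * γ i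

theorem relCoord_self (h : SmoothNear d χ γ j) : H.relCoord χ γ j j = γ j := by
  let r : unitInterval → M := fun i => χ i 1
  have hr : PiecewiseSmooth n r := h.2.1
  have hp := h.eventually_tip.self_of_nhds
  let q := (χ j).prolong (pathBetween r j j) (hr.pathBetween j j) (by rw [pathBetween_zero, hp])
  have hq : q 1 = χ j 1 := (pcomp_one _ _).trans ((pathBetween_one r j j).trans hp.symm)
  have hself : H.val (pinv q ⊙ χ j) = 1 := (H.val_pathBetween_self hr hp rfl).trans (H.val_self _)
  have htrans := H.val_trans hq (rfl : χ j 1 = χ j 1)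
  rw [hself, one_mul, H.val_self] at htrans
  exact mul_eq_right.2 htrans

variable [IsManifold (𝓡 n) ∞ M] [ConnectedSpace M] [LieGroup (𝓡 d) ∞ G]
  {φ : OpenPartialHomeomorph M (Euc n)} {ψ : LocalFamily n b}

theorem hasMFDerivAt_cls_smoothNear (h : SmoothNear d χ γ j)
    (hφ : φ ∈ IsManifold.maximalAtlas (𝓡 n) ∞ M) (hψ : ψ.IsStraight φ (χ j)) :
    ∃ v : ℝ →L[ℝ] Euc n, ∃ η : ℝ →L[ℝ] Euc d,
      HasMFDerivAt 𝓘(ℝ, ℝ) (𝓡 d) (H.relCoord χ γ j) j η ∧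
      HasMFDerivAt 𝓘(ℝ, ℝ) ((𝓡 n).prod (𝓡 d)) (fun i => H.cls (χ i) (γ i)) j
        ((H.trivDeriv ψ (χ j 1) (γ j)).comp (v.prod η)) := by
  let r : unitInterval → M := fun i => χ i 1
  have htip := h.eventually_tip
  have hrj := h.eventually_contMDiffAt_tip
  have hr := (hrj.self_of_nhds.mdifferentiableAt (by simp)).hasMFDerivAt
  have hval : MDifferentiableAt 𝓘(ℝ, ℝ) (𝓡 d)
      (fun i => H.val (pinv (χ i) ⊙ ψ (IccExtend zero_le_one r i)) * γ i) j := by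
    refine (h.mdifferentiableAt_val H hψ.mem).congr_of_eventuallyEq ?_
    filter_upwards [htip] with i hi
    rw [← hi]
  exact ⟨_, _, (H.hasMFDerivAt_val_localFamily_iff hφ hψ h.2.1 h.1 hrj htip.self_of_nhds htip).1
    hval.hasMFDerivAt, H.hasMFDerivAt_cls_curve hψ.mem (hψ.cls_eq H (γ j)).symm htip hr
    hval.hasMFDerivAt⟩

theorem mdifferentiableAt_cls (h : SmoothNear d χ γ j) :
    MDifferentiableAt 𝓘(ℝ, ℝ) ((𝓡 n).prod (𝓡 d)) (fun i => H.cls (χ i) (γ i)) j := by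
  obtain ⟨φ, hφ, ψ, hψ⟩ := LocalFamily.exists_chart_isStraight (χ j)
  obtain ⟨v, η, -, hcls⟩ := H.hasMFDerivAt_cls_smoothNear h hφ hψ
  exact hcls.mdifferentiableAt

theorem mdifferentiableAt_relCoord (h : SmoothNear d χ γ j) :
    MDifferentiableAt 𝓘(ℝ, ℝ) (𝓡 d) (H.relCoord χ γ j) j := by
  obtain ⟨φ, hφ, ψ, hψ⟩ := LocalFamily.exists_chart_isStraight (χ j)
  obtain ⟨v, η, hη, -⟩ := H.hasMFDerivAt_cls_smoothNear h hφ hψ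
  exact hη.mdifferentiableAt

theorem connForm_velocity (h : SmoothNear d χ γ j) :
    H.connForm (H.cls (χ j) (γ j)) (H.velocity (fun i => H.cls (χ i) (γ i)) j) =
      mfderiv (𝓡 d) (𝓡 d) (fun g : G => (γ j)⁻¹ * g) (γ j)
        (mfderiv 𝓘(ℝ, ℝ) (𝓡 d) (H.relCoord χ γ j) j (1 : ℝ)) := by
  obtain ⟨φ, hφ, ψ, hψ⟩ := LocalFamily.exists_chart_isStraight (χ j)
  obtain ⟨v, η, hη, hcls⟩ := H.hasMFDerivAt_cls_smoothNear h hφ hψ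
  rw [velocity, hcls.mfderiv, hη.mfderiv]
  exact H.connForm_trivDeriv hφ hψ (hψ.cls_eq H (γ j)) (v 1) (η 1)

end HolonomyMap

end HolonomyFormula

section LocalCoefficients

variable {n d : ℕ} {M : Type*} [TopologicalSpace M] [ChartedSpace (Euc n) M]
  {b : M} {G : Type*} [Group G] [TopologicalSpace G] [ChartedSpace (Euc d) G]

namespace HolonomyMap

variable (H : HolonomyMap n d b G) {ψ ψ' : LocalFamily n b} {x : M}
  {φ : OpenPartialHomeomorph M (Euc n)}

theorem hasMFDerivAt_val_straightPath (hφ : φ ∈ IsManifold.maximalAtlas (𝓡 n) ∞ M)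
    (hx : x ∈ ψ.U) (hψ' : ψ'.IsStraight φ (ψ x)) {η : Euc n →L[ℝ] Euc d}
    (hη : HasMFDerivAt (𝓡 n) (𝓡 d) (fun u => H.val (pinv (ψ u) ⊙ ψ' u)) x η) :
    HasMFDerivAt (𝓡 n) (𝓡 d)
      (fun y => H.val (pinv (ψ (φ.symm y)) ⊙ straightPath φ y (φ x) ⊙ ψ x)) (φ x)
      (η.comp (mfderiv (𝓡 n) (𝓡 n) φ.symm (φ x))) := by
  have htip := ψ.tip x hx
  have hxU : x ∈ ψ'.U := htip ▸ hψ'.mem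
  have hxφ : x ∈ φ.source := hψ'.subset hxU
  have hsymm : ContMDiffAt (𝓡 n) (𝓡 n) ∞ φ.symm (φ x) :=
    (contMDiffOn_symm_of_mem_maximalAtlas hφ).contMDiffAt
      (φ.open_target.mem_nhds (φ.map_source hxφ))
  rw [← φ.left_inv hxφ] at hη
  refine (HasMFDerivAt.comp (φ x) hη (hsymm.mdifferentiableAt
    (by simp)).hasMFDerivAt).congr_of_eventuallyEq ?_
  filter_upwards [φ.open_target.mem_nhds (φ.map_source hxφ), hsymm.continuousAt.eventually
    (ψ'.isOpen.mem_nhds ((φ.left_inv hxφ).symm ▸ hxU))] with y hy hyU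
  simp only [Function.comp_apply, hψ'.eq _ hyU, htip, φ.right_inv hy]

variable [IsManifold (𝓡 n) ∞ M] [ConnectedSpace M] [LieGroup (𝓡 d) ∞ G]

theorem hasMFDerivAt_localSection (hx : x ∈ ψ.U) (hx' : x ∈ ψ'.U) {η : Euc n →L[ℝ] Euc d}
    (hη : HasMFDerivAt (𝓡 n) (𝓡 d) (fun u => H.val (pinv (ψ u) ⊙ ψ' u)) x η) :
    HasMFDerivAt (𝓡 n) ((𝓡 n).prod (𝓡 d)) (H.localSection ψ) x
      ((H.trivDeriv ψ' x (H.val (pinv (ψ x) ⊙ ψ' x))).comp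
        ((ContinuousLinearMap.id ℝ _).prod η)) := by
  refine (HasMFDerivAt.comp (f := fun u => (u, H.val (pinv (ψ u) ⊙ ψ' u))) x
    (H.hasMFDerivAt_cls hx' _) ((hasMFDerivAt_id x).prodMk hη)).congr_of_eventuallyEq ?_
  filter_upwards [(ψ.isOpen.inter ψ'.isOpen).mem_nhds ⟨hx, hx'⟩] with u hu
  have hcls := H.cls_eq_cls_localFamily (p := ψ u) ((ψ.tip u hu.1).symm ▸ hu.2) 1
  rwa [ψ.tip u hu.1, mul_one] at hcls

theorem localCoeff_eq (hφ : φ ∈ IsManifold.maximalAtlas (𝓡 n) ∞ M) (hx : x ∈ φ.source)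
    (hxψ : x ∈ ψ.U) :
    let F : Euc n → G := fun y => H.val (pinv (ψ (φ.symm y)) ⊙ straightPath φ y (φ x) ⊙ ψ x)
    MDifferentiableAt (𝓡 n) ((𝓡 n).prod (𝓡 d)) (H.localSection ψ) x ∧
    MDifferentiableAt (𝓡 n) (𝓡 d) F (φ x) ∧ F (φ x) = 1 ∧
    ∀ μ : Fin n, H.localCoeff ψ φ μ x =
      mfderiv (𝓡 n) (𝓡 d) F (φ x) (EuclideanSpace.single μ (1 : ℝ)) := by
  intro F
  have htip := ψ.tip x hxψ
  obtain ⟨ψ', hψ'⟩ := LocalFamily.exists_isStraight hφ (p := ψ x) (by rwa [htip])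
  have hxψ' : x ∈ ψ'.U := htip ▸ hψ'.mem
  have hval : H.val (pinv (ψ x) ⊙ ψ' x) = 1 := by simpa only [htip] using hψ'.val_eq_one H
  have htrans : MDifferentiableAt (𝓡 n) (𝓡 d) (fun u => H.val (pinv (ψ u) ⊙ ψ' u)) x :=
    ((H.contMDiffOn_transition ψ ψ').contMDiffAt
      ((ψ.isOpen.inter ψ'.isOpen).mem_nhds ⟨hxψ, hxψ'⟩)).mdifferentiableAt (by simp)
  have hσ := H.hasMFDerivAt_localSection hxψ hxψ' htrans.hasMFDerivAt
  have hF := H.hasMFDerivAt_val_straightPath hφ hxψ hψ' htrans.hasMFDerivAt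
  have hF1 : F (φ x) = 1 := by
    simpa only [F, φ.left_inv hx, hψ'.eq x hxψ', htip] using hval
  have hconn := H.connForm_trivDeriv hφ hψ' (hψ'.cls_eq H 1)
  simp only [htip] at hconn
  have hone : HasMFDerivAt (𝓡 d) (𝓡 d) (fun h : G => 1⁻¹ * h) 1 (ContinuousLinearMap.id ℝ _) :=
    (hasMFDerivAt_id 1).congr_of_eventuallyEq (Eventually.of_forall fun h => by simp)
  refine ⟨hσ.mdifferentiableAt, hF.mdifferentiableAt, hF1, fun μ => ?_⟩
  rw [localCoeff, hσ.mfderiv, hF.mfderiv, hval]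
  exact (hconn _ _).trans (DFunLike.congr_fun hone.mfderiv _)

end HolonomyMap

end LocalCoefficients

end LoopHolonomy

theorem mainTheorem2_general {n d : ℕ}
    {M : Type*} [TopologicalSpace M] [ConnectedSpace M]
    [ChartedSpace (Euc n) M] [IsManifold (𝓡 n) ∞ M]
    {G : Type*} [Group G] [TopologicalSpace G] [ChartedSpace (Euc d) G] [LieGroup (𝓡 d) ∞ G]
    (b : M) (H : HolonomyMap n d b G) :
    (∀ a : H.Total, IsCompl (H.vertical a) (H.horizontal a) ∧
      Function.Injective (H.orbitDeriv a) ∧ range (H.orbitDeriv a) = H.vertical a) ∧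
    (∀ (a : H.Total) (X : TangentSpace ((𝓡 n).prod (𝓡 d)) a),
      ∃ (χ : ℝ → BasedPath n b) (g : ℝ → G) (j : ℝ), SmoothNear d χ g j ∧ χ 0 1 = b ∧
        H.cls (χ j) (g j) = a ∧ X = H.velocity (fun i => H.cls (χ i) (g i)) j) ∧
    (∀ (χ : ℝ → BasedPath n b) (g : ℝ → G) (j : ℝ), SmoothNear d χ g j →
      let p : unitInterval → M := fun i => χ i 1
      let K : ℝ → unitInterval → M := fun i => contr p (projIcc 0 1 zero_le_one i)
      let F : ℝ → G := fun i => H.val (pinv (χ i) ⊙ (K i ⊙ pinv (K j)) ⊙ χ j) * g i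
      MDifferentiableAt 𝓘(ℝ, ℝ) ((𝓡 n).prod (𝓡 d)) (fun i => H.cls (χ i) (g i)) j ∧
      MDifferentiableAt 𝓘(ℝ, ℝ) (𝓡 d) F j ∧ F j = g j ∧
      H.connForm (H.cls (χ j) (g j)) (H.velocity (fun i => H.cls (χ i) (g i)) j) =
        mfderiv (𝓡 d) (𝓡 d) (fun x : G => (g j)⁻¹ * x) (g j)
          (mfderiv 𝓘(ℝ, ℝ) (𝓡 d) F j (1 : ℝ))) ∧
    (∀ (ψ : LocalFamily n b) (φ : OpenPartialHomeomorph M (Euc n)),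
      φ ∈ IsManifold.maximalAtlas (𝓡 n) ∞ M → ∀ x ∈ φ.source, x ∈ ψ.U →
        let F : Euc n → G := fun y =>
          H.val (pinv (ψ (φ.symm y)) ⊙ straightPath φ y (φ x) ⊙ ψ x)
        MDifferentiableAt (𝓡 n) ((𝓡 n).prod (𝓡 d)) (H.localSection ψ) x ∧
        MDifferentiableAt (𝓡 n) (𝓡 d) F (φ x) ∧ F (φ x) = 1 ∧
        ∀ μ : Fin n, H.localCoeff ψ φ μ x =
          mfderiv (𝓡 n) (𝓡 d) F (φ x) (EuclideanSpace.single μ (1 : ℝ))) :=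
  ⟨fun a => ⟨H.isCompl_vertical_horizontal a, H.injective_orbitDeriv a, H.range_orbitDeriv a⟩,
    H.exists_eq_velocity,
    fun _ _ _ h => ⟨H.mdifferentiableAt_cls h, H.mdifferentiableAt_relCoord h, H.relCoord_self h,
      H.connForm_velocity h⟩,
    fun _ _ hφ _ hx hxψ => H.localCoeff_eq hφ hx hxψ⟩

theorem mainTheorem2 {n d : ℕ}
    {M : Type*} [TopologicalSpace M] [T2Space M] [ConnectedSpace M]
    [ChartedSpace (Euc n) M] [IsManifold (𝓡 n) ∞ M]
    {G : Type*} [Group G] [TopologicalSpace G] [ChartedSpace (Euc d) G] [LieGroup (𝓡 d) ∞ G]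
    (b : M) (H : HolonomyMap n d b G) :
    -- The vertical projection and the inverse of the differential of `g ↦ ag` make sense.
    (∀ a : H.Total, IsCompl (H.vertical a) (H.horizontal a) ∧
      Function.Injective (H.orbitDeriv a) ∧ range (H.orbitDeriv a) = H.vertical a) ∧
    -- Every tangent vector of `E` has the form `d/di {χ[i],g(i)}` at `i = j`.
    (∀ (a : H.Total) (X : TangentSpace ((𝓡 n).prod (𝓡 d)) a),
      ∃ (χ : ℝ → BasedPath n b) (g : ℝ → G) (j : ℝ), SmoothNear d χ g j ∧ χ 0 1 = b ∧
        H.cls (χ j) (g j) = a ∧ X = H.velocity (fun i => H.cls (χ i) (g i)) j) ∧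
    -- The holonomy expression for the connection 1-form.
    (∀ (χ : ℝ → BasedPath n b) (g : ℝ → G) (j : ℝ), SmoothNear d χ g j →
      let p : unitInterval → M := fun i => χ i 1
      let K : ℝ → unitInterval → M := fun i => contr p (projIcc 0 1 zero_le_one i)
      let F : ℝ → G := fun i => H.val (pinv (χ i) ⊙ (K i ⊙ pinv (K j)) ⊙ χ j) * g i
      MDifferentiableAt 𝓘(ℝ, ℝ) ((𝓡 n).prod (𝓡 d)) (fun i => H.cls (χ i) (g i)) j ∧
      MDifferentiableAt 𝓘(ℝ, ℝ) (𝓡 d) F j ∧ F j = g j ∧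
      H.connForm (H.cls (χ j) (g j)) (H.velocity (fun i => H.cls (χ i) (g i)) j) =
        mfderiv (𝓡 d) (𝓡 d) (fun x : G => (g j)⁻¹ * x) (g j)
          (mfderiv 𝓘(ℝ, ℝ) (𝓡 d) F j (1 : ℝ))) ∧
    -- The local coefficients.
    (∀ (ψ : LocalFamily n b) (φ : OpenPartialHomeomorph M (Euc n)),
      φ ∈ IsManifold.maximalAtlas (𝓡 n) ∞ M → φ.source ⊆ ψ.U → Convex ℝ φ.target →
      ∀ x ∈ φ.source,
        let F : Euc n → G := fun y =>
          H.val (pinv (ψ (φ.symm y)) ⊙ straightPath φ y (φ x) ⊙ ψ x)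
        MDifferentiableAt (𝓡 n) ((𝓡 n).prod (𝓡 d)) (H.localSection ψ) x ∧
        MDifferentiableAt (𝓡 n) (𝓡 d) F (φ x) ∧ F (φ x) = 1 ∧
        ∀ μ : Fin n, H.localCoeff ψ φ μ x =
          mfderiv (𝓡 n) (𝓡 d) F (φ x) (EuclideanSpace.single μ (1 : ℝ))) := by
  obtain ⟨hsplit, hvelocity, hformula, hcoeff⟩ := mainTheorem2_general b H
  exact ⟨hsplit, hvelocity, hformula, fun ψ φ hφ hU _ x hx => hcoeff ψ φ hφ x hx (hU hx)⟩
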